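/- Let $p_1>\cdots>p_l$ be odd primes with $p_j=2p_{j+1}+1$ for $1\le j\le l-1$, let $I\subseteq\{2,\ldots,l\}$ be a set containing no two consecutive integers, and for each $i\in I$ let $k_i$ be an integer of multiplicative order $p_i$ modulo $p_{i-1}$. Let $$N=\langle\sigma_1,\ldots,\sigma_l\mid \sigma_i\sigma_{i-1}=\sigma_{i-1}^{k_i}\sigma_i\ \ (i\in I)\rangle\cong C_m\times\prod_{i\in I}(C_{p_{i-1}}\rtimes C_{p_i}),$$ where $\sigma_j$ has order $p_j$, generators commute whenever no relation between them is given, $m$ is the product of the $p_j$ with $j\notin I$ and $j+1\notin I$, and $C_m$ is identified with the subgroup generated by the corresponding $\sigma_j$. Let $\mathrm{Hol}(N)=N\rtimes\mathrm{Aut}(N)$, with $[\eta,f][\mu,g]=[\eta f(\mu),fg]$, act on $N$ by $[\eta,f]\cdot x=\eta f(x)$. Let $\pi:\mathrm{Hol}(N)\to\mathrm{Aut}(C_m)$ be given by $[\eta,f]\mapsto f|_{C_m}$. Fix $i\in I$ with $i\ge 3$ and $i-2\notin I$, so that $p_{i-2}\mid m$. Let $\alpha_{i-2}$ be an automorphism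 of $\langle\sigma_{i-2}\rangle$ of order $p_{i-1}$, extended to $N$ by fixing all other generators. Let $\theta_i\in\mathrm{Aut}(N)$ send $\sigma_i$ to $\sigma_{i-1}\sigma_i$ and fix all other generators, and put $$\mathbf e_1=\sigma_{i-1},\qquad \mathbf e_2=[\sigma_{i-1},\theta_i^{k_i-1}],\qquad P_{i-1}=\langle\mathbf e_1,\mathbf e_2\rangle\cong\mathbb F_{p_{i-1}}^2 .$$ The subgroup $P_{i-1}$ is normal in $\mathrm{Hol}(N)$, and each element of $\mathrm{Hol}(N)$ acts on it by conjugation as a diagonal matrix in the basis $\mathbf e_1,\mathbf e_2$; let $\omega:\mathrm{Hol}(N)\to\mathrm{GL}_2(\mathbb F_{p_{i-1}})$ be this action. (It is the projection of $\mathrm{Hol}(N)$ to its factor $\mathrm{Hol}(C_{p_{i-1}}\rtimes C_{p_i})=P_{i-1}\rtimes R_i$ followed by the quotient map to $R_i$.) Put $S_i=\mathrm{diag}(k_i,1)$ and $A_i=\mathrm{diag}(k_i,k_i)$. Write $P_{i-1}$ additively, and write $(\alpha_{i-2},\lambda\mathbf e_j)$ for the product of the commuting elements $\alpha_{i-2}$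 and $\mathbf e_j^{\lambda}$. Let $M\le\mathrm{Hol}(N)$ be transitive on $N$ with $\alpha_{i-2}|_{C_m}\in\pi(M)$. Then $M$ has a Sylow $p_{i-1}$-subgroup that is one of the following groups, where $1\le\lambda\le p_{i-1}-1$: 1. $\langle\alpha_{i-2},\mathbf e_1,\mathbf e_2\rangle$, $\langle\alpha_{i-2},\mathbf e_1\rangle$ or $\langle\alpha_{i-2},\mathbf e_2\rangle$; 2. $\langle\mathbf e_1,(\alpha_{i-2},\lambda\mathbf e_2)\rangle$ or $\langle(\alpha_{i-2},\lambda\mathbf e_2)\rangle$; 3. $\langle(\alpha_{i-2},\lambda\mathbf e_1),\mathbf e_2\rangle$ or $\langle(\alpha_{i-2},\lambda\mathbf e_1)\rangle$. Moreover, a group of type 2 is a Sylow $p_{i-1}$-subgroup of $M$ only if $\omega(M)=\langle S_i\rangle$, and a group of type 3 is one only if $\omega(M)=\langle S_iA_i^{-1}\rangle$. -/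

import Mathlib

/-- The parameters of a metacyclic group of Cunningham order: a Cunningham chain
`p 1 > ⋯ > p l` of odd primes with `p j = 2 * p (j + 1) + 1`, a set `I ⊆ {2, …, l}` without
consecutive elements, and for each `i ∈ I` an integer `k i` of order `p i` modulo `p (i - 1)`.
The values of `p` outside `{1, …, l}` and those of `k` outside `I` play no role. -/
structure CunninghamData where
  l : ℕ
  p : ℕ → ℕ
  prime_p : ∀ j ∈ Finset.Icc 1 l, (p j).Prime
  odd_p : ∀ j ∈ Finset.Icc 1 l, Odd (p j)
  chain : ∀ j, 1 ≤ j → j + 1 ≤ l → p j = 2 * p (j + 1) + 1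
  I : Finset ℕ
  I_subset : I ⊆ Finset.Icc 2 l
  I_sparse : ∀ i ∈ I, i + 1 ∉ I
  k : ℕ → ℕ
  orderOf_k : ∀ j, j + 1 ∈ I → orderOf ((k (j + 1) : ℕ) : ZMod (p j)) = p (j + 1)

/-- The holomorph `Hol(N) = N ⋊ Aut(N)`, with `[η, α][μ, β] = [η α(μ), αβ]`. -/
abbrev Hol (N : Type*) [Group N] := N ⋊[MonoidHom.id (MulAut N)] MulAut N

/-- A subgroup `M` of `Hol(N)` is transitive if it acts transitively on `N` through
`[η, α] · x = η α(x)`. -/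
def Hol.IsTransitive {N : Type*} [Group N] (M : Subgroup (Hol N)) : Prop :=
  ∀ x y : N, ∃ g ∈ M, g.left * g.right x = y

/-- `Q` is a Sylow `q`-subgroup of the subgroup `M` (both being subgroups of `G`). -/
def IsSylowIn {G : Type*} [Group G] (q : ℕ) (M Q : Subgroup G) : Prop :=
  ∃ P : Sylow q M, (P : Subgroup M).map M.subtype = Q

namespace CunninghamData

/-- The index set `{1, …, l}`. -/
abbrev Idx (D : CunninghamData) := {j : ℕ // j ∈ Finset.Icc 1 D.l}

variable (D : CunninghamData)

theorem mem_of_mem_I {i : ℕ} (h : i ∈ D.I) : i ∈ Finset.Icc 1 D.l := by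
  have := Finset.mem_Icc.1 (D.I_subset h)
  exact Finset.mem_Icc.2 ⟨by omega, this.2⟩

theorem mem_of_succ_mem_I {j : ℕ} (h : j + 1 ∈ D.I) : j ∈ Finset.Icc 1 D.l := by
  have := Finset.mem_Icc.1 (D.I_subset h)
  exact Finset.mem_Icc.2 ⟨by omega, by omega⟩

instance (j : D.Idx) : Fact (D.p j).Prime := ⟨D.prime_p j j.2⟩

/-- The underlying set of `N`: the tuple with coordinates `x j` stands for the product of the
`σ j ^ (x j)`, taken in the order of increasing `j`. -/
@[ext] structure N where
  coord : ∀ j : D.Idx, ZMod (D.p j)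

variable {D}

/-- The factor by which conjugation by `x` acts on the exponent of `σ j`:
it is `k (j + 1) ^ (x (j + 1))` if `j + 1 ∈ I`, and `1` otherwise. -/
def N.twist (x : D.N) (j : D.Idx) : ZMod (D.p j) :=
  if h : (j : ℕ) + 1 ∈ D.I then
    ((D.k (j + 1) : ℕ) : ZMod (D.p j)) ^ (x.coord ⟨j + 1, D.mem_of_mem_I h⟩).val
  else 1

/-- The multiplication of
`N = ⟨σ 1, …, σ l ∣ σ i * σ (i - 1) = σ (i - 1) ^ k i * σ i for i ∈ I⟩`
(`σ j` of order `p j`, all other pairs of generators commuting) on normal forms. -/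
instance : Mul D.N := ⟨fun x y => ⟨fun j => x.coord j + x.twist j * y.coord j⟩⟩

instance : One D.N := ⟨⟨fun _ => 0⟩⟩

instance : Inv D.N := ⟨fun x => ⟨fun j => -((x.twist j)⁻¹ * x.coord j)⟩⟩

theorem N.mul_coord (x y : D.N) (j : D.Idx) :
    (x * y).coord j = x.coord j + x.twist j * y.coord j := rfl

theorem N.one_coord (j : D.Idx) : (1 : D.N).coord j = 0 := rfl

theorem N.inv_coord (x : D.N) (j : D.Idx) :
    (x⁻¹).coord j = -((x.twist j)⁻¹ * x.coord j) := rfl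

theorem N.twist_of_notMem (x : D.N) (j : D.Idx) (h : (j : ℕ) + 1 ∉ D.I) : x.twist j = 1 := by
  simp [N.twist, h]

theorem N.twist_of_coord_eq_zero (x : D.N) (j : D.Idx)
    (h : ∀ h : (j : ℕ) + 1 ∈ D.I, x.coord ⟨j + 1, D.mem_of_mem_I h⟩ = 0) : x.twist j = 1 := by
  by_cases hj : (j : ℕ) + 1 ∈ D.I
  · simp [N.twist, hj, h hj]
  · simp [N.twist, hj]

theorem k_pow_mod (D : CunninghamData) (j : ℕ) (hj : j + 1 ∈ D.I) (n : ℕ) :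
    ((D.k (j + 1) : ℕ) : ZMod (D.p j)) ^ (n % D.p (j + 1)) =
      ((D.k (j + 1) : ℕ) : ZMod (D.p j)) ^ n := by
  have h := pow_mod_orderOf ((D.k (j + 1) : ℕ) : ZMod (D.p j)) n
  rwa [D.orderOf_k j hj] at h

theorem N.twist_mul (x y : D.N) (j : D.Idx) : (x * y).twist j = x.twist j * y.twist j := by
  by_cases hj : (j : ℕ) + 1 ∈ D.I
  · have : Fact (D.p (j + 1)).Prime := ⟨D.prime_p _ (D.mem_of_mem_I hj)⟩
    have h1 : (x * y).coord ⟨j + 1, D.mem_of_mem_I hj⟩ =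
        x.coord ⟨j + 1, D.mem_of_mem_I hj⟩ + y.coord ⟨j + 1, D.mem_of_mem_I hj⟩ := by
      rw [N.mul_coord, N.twist_of_notMem _ _ (D.I_sparse _ hj), one_mul]
    simp only [N.twist, hj, dite_true]
    rw [h1, ← pow_add, ZMod.val_add, D.k_pow_mod j hj]
  · simp [N.twist, hj]

theorem N.twist_one (j : D.Idx) : (1 : D.N).twist j = 1 :=
  N.twist_of_coord_eq_zero _ _ fun _ => rfl

theorem k_ne_zero (j : D.Idx) (hj : (j : ℕ) + 1 ∈ D.I) :
    ((D.k (j + 1) : ℕ) : ZMod (D.p j)) ≠ 0 := by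
  intro h
  have h1 := D.orderOf_k j hj
  have h2 := (D.prime_p _ (D.mem_of_mem_I hj)).pos
  rw [h] at h1
  have h3 := pow_orderOf_eq_one (0 : ZMod (D.p j))
  rw [h1, zero_pow h2.ne'] at h3
  exact zero_ne_one h3

theorem k_ne_one (j : D.Idx) (hj : (j : ℕ) + 1 ∈ D.I) :
    ((D.k (j + 1) : ℕ) : ZMod (D.p j)) ≠ 1 := by
  intro h
  have h1 := D.orderOf_k j hj
  rw [h, orderOf_one] at h1
  exact (D.prime_p _ (D.mem_of_mem_I hj)).one_lt.ne h1

theorem N.twist_ne_zero (x : D.N) (j : D.Idx) : x.twist j ≠ 0 := by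
  by_cases hj : (j : ℕ) + 1 ∈ D.I
  · simp only [N.twist, hj, dite_true]
    exact pow_ne_zero _ (k_ne_zero j hj)
  · simp [N.twist, hj]

instance : Group D.N :=
  Group.ofLeftAxioms
    (fun x y z => by
      ext j
      simp only [N.mul_coord, N.twist_mul]
      ring)
    (fun x => by
      ext j
      simp [N.mul_coord, N.one_coord, N.twist_one])
    (fun x => by
      ext j
      have h := N.twist_ne_zero x j
      have h2 : (x⁻¹).twist j = (x.twist j)⁻¹ := by
        by_cases hj : (j : ℕ) + 1 ∈ D.I
        · have h3 : (x⁻¹ * x).twist j = 1 := by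
            refine N.twist_of_coord_eq_zero _ _ fun _ => ?_
            rw [N.mul_coord, N.inv_coord]
            have h4 := D.I_sparse _ hj
            rw [N.twist_of_notMem _ _ h4, N.twist_of_notMem _ _ h4]
            simp
          rw [N.twist_mul] at h3
          exact eq_inv_of_mul_eq_one_left h3
        · simp [N.twist, hj]
      rw [N.mul_coord, N.one_coord, N.inv_coord, h2]
      ring)


theorem N.coord_pow (x : D.N) (j : D.Idx) (h : x.twist j = 1) (n : ℕ) :
    (x ^ n).coord j = n * x.coord j := by
  have ht : ∀ n : ℕ, (x ^ n).twist j = 1 := by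
    intro n
    induction n with
    | zero => rw [pow_zero, N.twist_one]
    | succ n ih => rw [pow_succ, N.twist_mul, ih, h, one_mul]
  induction n with
  | zero => simp [N.one_coord]
  | succ n ih =>
    rw [pow_succ, N.mul_coord, ih, ht]
    push_cast
    ring

theorem p_lt (D : CunninghamData) {a b : ℕ} (ha : 1 ≤ a) (hab : a < b) (hb : b ≤ D.l) :
    D.p b < D.p a := by
  induction b, hab using Nat.le_induction with
  | base =>
    have := D.chain a ha hb
    rw [Nat.succ_eq_add_one]
    omega
  | succ b hab ih =>
    have h1 := ih (by omega)
    have h2 := D.chain b (by omega) hb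
    omega

theorem natCast_p_ne_zero {a b : D.Idx} (h : a ≠ b) : ((D.p a : ℕ) : ZMod (D.p b)) ≠ 0 := by
  intro h0
  rw [ZMod.natCast_eq_zero_iff, Nat.prime_dvd_prime_iff_eq (D.prime_p b b.2) (D.prime_p a a.2)]
    at h0
  have ha := Finset.mem_Icc.1 a.2
  have hb := Finset.mem_Icc.1 b.2
  rcases lt_or_gt_of_ne (fun h' => h (Subtype.ext h') : (a : ℕ) ≠ b) with h1 | h1
  · have := D.p_lt ha.1 h1 hb.2
    omega
  · have := D.p_lt hb.1 h1 ha.2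
    omega

/-- The generator `σ j` of `N`. -/
def σ (D : CunninghamData) (j : D.Idx) : D.N := ⟨Pi.single j 1⟩

/-- `p j` divides `m = n / ∏_{i ∈ I} p (i - 1) p i`, that is, `σ j` lies in the factor `C_m`. -/
def InCm (D : CunninghamData) (j : D.Idx) : Prop := (j : ℕ) ∉ D.I ∧ (j : ℕ) + 1 ∉ D.I

/-- The factor `C_m = ⟨σ j ∣ p j divides m⟩` of `N`. -/
def Cm (D : CunninghamData) : Subgroup D.N where
  carrier := {x | ∀ j, ¬ D.InCm j → x.coord j = 0}
  one_mem' := fun _ _ => rfl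
  mul_mem' := fun {x y} hx hy j hj => by rw [N.mul_coord, hx j hj, hy j hj]; ring
  inv_mem' := fun {x} hx j hj => by rw [N.inv_coord, hx j hj]; ring

/-- For `i = j + 1 ∈ I`, the index `i - 1` of the normal subgroup in the factor
`C_{p (i - 1)} ⋊ C_{p i}` of `N`. -/
def bot (D : CunninghamData) {j : ℕ} (h : j + 1 ∈ D.I) : D.Idx := ⟨j, D.mem_of_succ_mem_I h⟩

/-- For `i = j + 1 ∈ I`, the index `i` of the complement in the factor
`C_{p (i - 1)} ⋊ C_{p i}` of `N`. -/
def top (D : CunninghamData) {j : ℕ} (h : j + 1 ∈ D.I) : D.Idx := ⟨j + 1, D.mem_of_mem_I h⟩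

theorem σ_coord_self (j : D.Idx) : (D.σ j).coord j = 1 := by simp [σ]

theorem σ_coord_of_ne {j a : D.Idx} (h : a ≠ j) : (D.σ j).coord a = 0 := by simp [σ, h]

/-- The integer `k i` modulo `p (i - 1)`, where `i = j + 1 ∈ I`. -/
def kmod (D : CunninghamData) {j : ℕ} (h : j + 1 ∈ D.I) : ZMod (D.p (D.bot h)) :=
  ((D.k (j + 1) : ℕ) : ZMod (D.p (D.bot h)))

theorem kmod_ne_zero {j : ℕ} (h : j + 1 ∈ D.I) : D.kmod h ≠ 0 := k_ne_zero (D.bot h) h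

theorem kmod_ne_one {j : ℕ} (h : j + 1 ∈ D.I) : D.kmod h ≠ 1 := k_ne_one (D.bot h) h

theorem N.twist_bot (x : D.N) {j : ℕ} (h : j + 1 ∈ D.I) :
    x.twist (D.bot h) = D.kmod h ^ (x.coord (D.top h)).val := by
  have h' : ((D.bot h : D.Idx) : ℕ) + 1 ∈ D.I := h
  simp only [N.twist, h', dite_true]
  rfl

theorem σ_top_twist {j : ℕ} (h : j + 1 ∈ D.I) : (D.σ (D.top h)).twist (D.bot h) = D.kmod h := by
  rw [N.twist_bot, σ_coord_self, ZMod.val_one, pow_one]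

theorem σ_bot_twist {j : ℕ} (h : j + 1 ∈ D.I) (a : D.Idx) : (D.σ (D.bot h)).twist a = 1 := by
  refine N.twist_of_coord_eq_zero _ _ fun ha => σ_coord_of_ne fun h' => ?_
  have h1 : (a : ℕ) + 1 = j := congrArg Subtype.val h'
  exact D.I_sparse _ (h1 ▸ ha) h

theorem σ_bot_pow_coord {j : ℕ} (h : j + 1 ∈ D.I) (n : ℕ) (a : D.Idx) :
    (D.σ (D.bot h) ^ n).coord a = n * (D.σ (D.bot h)).coord a :=
  N.coord_pow _ _ (σ_bot_twist h a) n

theorem σ_bot_pow_congr {j : ℕ} (h : j + 1 ∈ D.I) {m n : ℕ}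
    (hmn : (m : ZMod (D.p (D.bot h))) = n) : D.σ (D.bot h) ^ m = D.σ (D.bot h) ^ n := by
  ext a
  rw [σ_bot_pow_coord, σ_bot_pow_coord]
  by_cases ha : a = D.bot h
  · subst ha
    rw [hmn]
  · rw [σ_coord_of_ne ha, mul_zero, mul_zero]

theorem σ_bot_pow_inj {j : ℕ} (h : j + 1 ∈ D.I) {m n : ℕ}
    (hmn : D.σ (D.bot h) ^ m = D.σ (D.bot h) ^ n) : (m : ZMod (D.p (D.bot h))) = n := by
  have := congrArg (fun x => N.coord x (D.bot h)) hmn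
  simpa [σ_bot_pow_coord, σ_coord_self] using this

/-- `x * σ (i - 1) * x⁻¹ = σ (i - 1) ^ t` with `t = x.twist (i - 1)`. -/
theorem N.conj_σ_bot (x : D.N) {j : ℕ} (h : j + 1 ∈ D.I) :
    x * D.σ (D.bot h) = D.σ (D.bot h) ^ (x.twist (D.bot h)).val * x := by
  ext a
  have h1 : (D.σ (D.bot h) ^ (x.twist (D.bot h)).val).twist a = 1 := by
    refine N.twist_of_coord_eq_zero _ _ fun ha => ?_
    rw [σ_bot_pow_coord, σ_coord_of_ne, mul_zero]
    intro h'
    have h1 : (a : ℕ) + 1 = j := congrArg Subtype.val h'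
    exact D.I_sparse _ (h1 ▸ ha) h
  rw [N.mul_coord, N.mul_coord, h1, one_mul, σ_bot_pow_coord]
  by_cases ha : a = D.bot h
  · subst ha
    rw [σ_coord_self, ZMod.natCast_zmod_val]
    ring
  · rw [σ_coord_of_ne ha]
    ring

/-- The defining relation `σ i * σ (i - 1) = σ (i - 1) ^ k i * σ i` for `i = j + 1 ∈ I`. -/
theorem σ_top_mul_σ_bot {j : ℕ} (h : j + 1 ∈ D.I) :
    D.σ (D.top h) * D.σ (D.bot h) = D.σ (D.bot h) ^ D.k (j + 1) * D.σ (D.top h) := by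
  rw [N.conj_σ_bot, σ_top_twist]
  congr 1
  apply σ_bot_pow_congr
  rw [ZMod.natCast_zmod_val]
  rfl

/-- `C_m` is the centre of `N`. -/
theorem Cm_eq_center : D.Cm = Subgroup.center D.N := by
  ext x
  rw [Subgroup.mem_center_iff]
  constructor
  · intro hx y
    ext a
    have h1 : x.twist a = 1 := N.twist_of_coord_eq_zero _ _ fun ha => hx _ fun h => h.1 ha
    rw [N.mul_coord, N.mul_coord, h1, one_mul]
    by_cases ha : (a : ℕ) + 1 ∈ D.I
    · rw [hx a fun h => h.2 ha]
      ring
    · rw [N.twist_of_notMem _ _ ha]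
      ring
  · intro hx a ha
    have key : ∀ (j : ℕ) (h : j + 1 ∈ D.I),
        x.coord (D.top h) = 0 ∧ x.coord (D.bot h) = 0 := by
      intro j h
      have : NeZero (D.p (j + 1)) := ⟨(D.prime_p _ (D.mem_of_mem_I h)).ne_zero⟩
      have h1 : x.twist (D.bot h) = 1 := by
        have h2 := congrArg (fun y => N.coord y (D.bot h)) (hx (D.σ (D.bot h)))
        simp only [N.mul_coord, σ_bot_twist, σ_coord_self] at h2
        linear_combination -h2
      have h0 : x.coord (D.top h) = 0 := by
        rw [N.twist_bot] at h1
        have h2 := orderOf_dvd_of_pow_eq_one h1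
        have h3 : orderOf (D.kmod h) = D.p (j + 1) := D.orderOf_k j h
        rw [h3] at h2
        have h4 : (x.coord (D.top h)).val < D.p (j + 1) :=
          ZMod.val_lt (n := D.p (j + 1)) (x.coord (D.top h))
        exact (ZMod.val_eq_zero _).1 (Nat.eq_zero_of_dvd_of_lt h2 h4)
      refine ⟨h0, ?_⟩
      have h2 := congrArg (fun y => N.coord y (D.bot h)) (hx (D.σ (D.top h)))
      have hne : D.bot h ≠ D.top h := fun h' => by
        have := congrArg Subtype.val h'
        simp [bot, top] at this
      simp only [N.mul_coord, σ_top_twist, h1, σ_coord_of_ne hne] at h2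
      have h3 : (D.kmod h - 1) * x.coord (D.bot h) = 0 := by linear_combination h2
      exact (mul_eq_zero.1 h3).resolve_left (sub_ne_zero.2 (kmod_ne_one h))
    rw [InCm, not_and_or, not_not, not_not] at ha
    rcases ha with ha | ha
    · have h1 := Finset.mem_Icc.1 (D.I_subset ha)
      obtain ⟨a, ha'⟩ := a
      obtain ⟨j, rfl⟩ : ∃ j, a = j + 1 := ⟨a - 1, by simp at h1; omega⟩
      exact (key j ha).1
    · exact (key a ha).2

instance Cm_characteristic : D.Cm.Characteristic := by
  rw [Cm_eq_center]
  infer_instance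

/-- The projection `π : Hol(N) → Hol(C_m) → Aut(C_m)`, which restricts the automorphism part to
the characteristic factor `C_m`. -/
def π (D : CunninghamData) : Hol D.N →* MulAut D.Cm :=
  (MulAut.characteristic D.Cm).comp SemidirectProduct.rightHom

/-- The automorphism of `N` that raises `σ j` to the power `u`, for `p j` dividing `m`, and fixes
all other generators. Every automorphism of `⟨σ j⟩`, extended to `N`, has this form. -/
def powAut (D : CunninghamData) (j : D.Idx) (hj : D.InCm j) (u : (ZMod (D.p j))ˣ) :
    MulAut D.N where
  toFun x := ⟨Function.update x.coord j (u * x.coord j)⟩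
  invFun x := ⟨Function.update x.coord j ((u⁻¹ : (ZMod (D.p j))ˣ) * x.coord j)⟩
  left_inv x := by
    ext a
    by_cases h : a = j
    · subst h
      dsimp only
      rw [Function.update_self, Function.update_self, Units.inv_mul_cancel_left]
    · dsimp only
      rw [Function.update_of_ne h, Function.update_of_ne h]
  right_inv x := by
    ext a
    by_cases h : a = j
    · subst h
      dsimp only
      rw [Function.update_self, Function.update_self, Units.mul_inv_cancel_left]
    · dsimp only
      rw [Function.update_of_ne h, Function.update_of_ne h]
  map_mul' x y := by
    have ht : ∀ a : D.Idx,
        N.twist (⟨Function.update x.coord j (u * x.coord j)⟩ : D.N) a = x.twist a := by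
      intro a
      by_cases ha : (a : ℕ) + 1 ∈ D.I
      · have hne : (⟨a + 1, D.mem_of_mem_I ha⟩ : D.Idx) ≠ j := by
          rintro rfl
          exact hj.1 ha
        simp [N.twist, ha, hne]
      · simp [N.twist, ha]
    ext a
    rw [N.mul_coord (⟨Function.update x.coord j (u * x.coord j)⟩ : D.N), ht]
    by_cases h : a = j
    · subst h
      simp only [Function.update_self, N.mul_coord, N.twist_of_notMem _ _ hj.2]
      ring
    · simp [h, N.mul_coord]

/-- `⟨σ (i - 1)⟩` is invariant under automorphisms of `N`, for `i = j + 1 ∈ I`. -/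
theorem aut_σ_bot (f : MulAut D.N) {j : ℕ} (h : j + 1 ∈ D.I) :
    f (D.σ (D.bot h)) =
      D.σ (D.bot h) ^ ((f (D.σ (D.bot h))).coord (D.bot h)).val := by
  set z := f (D.σ (D.bot h)) with hz
  have hp : z ^ D.p (D.bot h) = 1 := by
    rw [hz, ← map_pow]
    have : D.σ (D.bot h) ^ D.p (D.bot h) = D.σ (D.bot h) ^ 0 := σ_bot_pow_congr h (by simp)
    rw [this, pow_zero, map_one]
  have h0 : ∀ a : D.Idx, z.twist a = 1 → a ≠ D.bot h → z.coord a = 0 := by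
    intro a ha hne
    have h1 := N.coord_pow z a ha (D.p (D.bot h))
    rw [hp, N.one_coord] at h1
    exact (mul_eq_zero.1 h1.symm).resolve_left (natCast_p_ne_zero hne.symm)
  have h1 : ∀ a : D.Idx, a ≠ D.bot h → z.coord a = 0 := by
    intro a hne
    refine h0 a (N.twist_of_coord_eq_zero _ _ fun ha => ?_) hne
    refine h0 _ (N.twist_of_notMem _ _ (D.I_sparse _ ha)) fun h' => ?_
    have h2 : (a : ℕ) + 1 = j := congrArg Subtype.val h'
    exact D.I_sparse _ (h2 ▸ ha) h
  ext a
  rw [σ_bot_pow_coord]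
  by_cases ha : a = D.bot h
  · subst ha
    rw [σ_coord_self, ZMod.natCast_zmod_val, mul_one]
  · rw [h1 a ha, σ_coord_of_ne ha, mul_zero]

/-- The exponent `c` with `f (σ (i - 1)) = σ (i - 1) ^ c`, for `i = j + 1 ∈ I`. -/
def botExp (f : MulAut D.N) {j : ℕ} (h : j + 1 ∈ D.I) : ZMod (D.p (D.bot h)) :=
  (f (D.σ (D.bot h))).coord (D.bot h)

theorem botExp_one {j : ℕ} (h : j + 1 ∈ D.I) : botExp (1 : MulAut D.N) h = 1 :=
  σ_coord_self _

theorem botExp_mul (f g : MulAut D.N) {j : ℕ} (h : j + 1 ∈ D.I) :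
    botExp (f * g) h = botExp f h * botExp g h := by
  have h1 : f (g (D.σ (D.bot h))) = D.σ (D.bot h) ^ ((botExp f h).val * (botExp g h).val) := by
    rw [aut_σ_bot g h, map_pow, aut_σ_bot f h, ← pow_mul]
    rfl
  change (f (g (D.σ (D.bot h)))).coord _ = _
  rw [h1, σ_bot_pow_coord, σ_coord_self]
  push_cast
  rw [ZMod.natCast_zmod_val, ZMod.natCast_zmod_val, mul_one]

theorem botExp_ne_zero (f : MulAut D.N) {j : ℕ} (h : j + 1 ∈ D.I) : botExp f h ≠ 0 := by
  intro h0
  have := botExp_mul f f⁻¹ h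
  rw [mul_inv_cancel, botExp_one, h0, zero_mul] at this
  exact one_ne_zero this

theorem twist_aut (f : MulAut D.N) (x : D.N) {j : ℕ} (h : j + 1 ∈ D.I) :
    (f x).twist (D.bot h) = x.twist (D.bot h) := by
  have h1 := congrArg f (x.conj_σ_bot h)
  have h3 : f (D.σ (D.bot h)) = D.σ (D.bot h) ^ (botExp f h).val := aut_σ_bot f h
  have h4 : ∀ n : ℕ, f x * D.σ (D.bot h) ^ n =
      D.σ (D.bot h) ^ (((f x).twist (D.bot h)).val * n) * f x := by
    intro n
    induction n with
    | zero => simp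
    | succ n ih =>
      rw [pow_succ, ← mul_assoc, ih, mul_assoc, N.conj_σ_bot, ← mul_assoc, ← pow_add]
      rfl
  rw [map_mul, map_mul, map_pow, h3, h4, ← pow_mul] at h1
  have h2 := σ_bot_pow_inj h (mul_right_cancel h1)
  push_cast at h2
  rw [ZMod.natCast_zmod_val, ZMod.natCast_zmod_val, ZMod.natCast_zmod_val, mul_comm] at h2
  exact mul_left_cancel₀ (botExp_ne_zero f h) h2

/-- The element `e₁ = σ (i - 1)` of `Hol(N)`, for `i = j + 1 ∈ I`. -/
def e₁ (D : CunninghamData) {j : ℕ} (h : j + 1 ∈ D.I) : Hol D.N := ⟨D.σ (D.bot h), 1⟩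

/-- The automorphism `θ i` of `N`, for `i = j + 1 ∈ I`: it maps `σ i` to `σ (i - 1) * σ i` and
fixes all other generators. It is conjugation by `σ (i - 1) ^ w`, where `w * (1 - k i) = 1`
modulo `p (i - 1)`. -/
def θ (D : CunninghamData) {j : ℕ} (h : j + 1 ∈ D.I) : MulAut D.N :=
  MulAut.conj (D.σ (D.bot h) ^ ((1 - D.kmod h)⁻¹).val)

theorem θ_σ_top {j : ℕ} (h : j + 1 ∈ D.I) :
    D.θ h (D.σ (D.top h)) = D.σ (D.bot h) * D.σ (D.top h) := by
  have hc : ∀ n : ℕ, D.σ (D.top h) * D.σ (D.bot h) ^ n =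
      D.σ (D.bot h) ^ (D.k (j + 1) * n) * D.σ (D.top h) := by
    intro n
    induction n with
    | zero => simp
    | succ n ih =>
      rw [pow_succ, ← mul_assoc, ih, mul_assoc, σ_top_mul_σ_bot, ← mul_assoc, ← pow_add]
      rfl
  rw [θ, MulAut.conj_apply, mul_inv_eq_iff_eq_mul, mul_assoc, hc, ← mul_assoc, ← pow_succ']
  congr 1
  apply σ_bot_pow_congr
  push_cast
  have h1 : (1 : ZMod (D.p (D.bot h))) - D.kmod h ≠ 0 := sub_ne_zero.2 (kmod_ne_one h).symm
  have h2 : ((D.k (j + 1) : ℕ) : ZMod (D.p (D.bot h))) = D.kmod h := rfl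
  rw [ZMod.natCast_zmod_val, h2]
  field_simp
  ring

theorem θ_σ_of_ne {j : ℕ} (h : j + 1 ∈ D.I) (a : D.Idx) (ha : a ≠ D.top h) :
    D.θ h (D.σ a) = D.σ a := by
  have h1 : (D.σ a).twist (D.bot h) = 1 := by
    rw [N.twist_bot, σ_coord_of_ne ha.symm, ZMod.val_zero, pow_zero]
  have h2 : Commute (D.σ a) (D.σ (D.bot h)) := by
    have := (D.σ a).conj_σ_bot h
    rwa [h1, ZMod.val_one, pow_one] at this
  rw [θ, MulAut.conj_apply, mul_inv_eq_iff_eq_mul]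
  exact (h2.pow_right _).symm

/-- The element `e₂ = [σ (i - 1), θ i ^ (k i - 1)]` of `Hol(N)`, for `i = j + 1 ∈ I`. -/
def e₂ (D : CunninghamData) {j : ℕ} (h : j + 1 ∈ D.I) : Hol D.N :=
  ⟨D.σ (D.bot h), D.θ h ^ ((D.k (j + 1) : ℤ) - 1)⟩

/-- The map `ω : Hol(N) → R i ≤ GL₂(𝔽_{p (i - 1)})`, for `i = j + 1 ∈ I`: the projection of
`Hol(N)` to its factor `Hol(C_{p (i - 1)} ⋊ C_{p i}) = P (i - 1) ⋊ R i`, followed by the quotient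
map to `R i`, whose elements are written as matrices of their conjugation action on
`P (i - 1) = ⟨e₁, e₂⟩`. An element `[η, f]` acts there by
`e₁ ↦ (η f(σ (i - 1)) η⁻¹) = e₁ ^ (t * c)` and `e₂ ↦ e₂ ^ c`, with `t` and `c` the exponents given
by `η * σ (i - 1) * η⁻¹ = σ (i - 1) ^ t` and `f (σ (i - 1)) = σ (i - 1) ^ c`
(see `conj_e₁` and `conj_e₂`). -/
def ω (D : CunninghamData) {j : ℕ} (h : j + 1 ∈ D.I) :
    Hol D.N →* GL (Fin 2) (ZMod (D.p (D.bot h))) :=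
  MonoidHom.toHomUnits
    { toFun := fun g => !![g.left.twist (D.bot h) * botExp g.right h, 0; 0, botExp g.right h]
      map_one' := by
        rw [SemidirectProduct.one_left, SemidirectProduct.one_right, N.twist_one, botExp_one,
          one_mul]
        exact Matrix.one_fin_two.symm
      map_mul' := fun a b => by
        rw [SemidirectProduct.mul_left, SemidirectProduct.mul_right, N.twist_mul, botExp_mul,
          MonoidHom.id_apply, twist_aut, Matrix.mul_fin_two]
        congr 1
        simp
        ring }

theorem ω_coe {j : ℕ} (h : j + 1 ∈ D.I) (g : Hol D.N) :
    (D.ω h g : Matrix (Fin 2) (Fin 2) (ZMod (D.p (D.bot h)))) =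
      !![g.left.twist (D.bot h) * botExp g.right h, 0; 0, botExp g.right h] := rfl

/-- Conjugation by `g` raises `e₁` to the power given by the first diagonal entry of `ω g`. -/
theorem conj_e₁ {j : ℕ} (h : j + 1 ∈ D.I) (g : Hol D.N) :
    g * D.e₁ h * g⁻¹ =
      D.e₁ h ^ ((D.ω h g : Matrix (Fin 2) (Fin 2) (ZMod (D.p (D.bot h)))) 0 0).val := by
  have h1 : ∀ n : ℕ, D.e₁ h ^ n = SemidirectProduct.inl (D.σ (D.bot h) ^ n) := fun n =>
    (map_pow (SemidirectProduct.inl (φ := MonoidHom.id (MulAut D.N))) _ n).symm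
  have h4 : ∀ n : ℕ, g.left * D.σ (D.bot h) ^ n =
      D.σ (D.bot h) ^ ((g.left.twist (D.bot h)).val * n) * g.left := by
    intro n
    induction n with
    | zero => simp
    | succ n ih =>
      rw [pow_succ, ← mul_assoc, ih, mul_assoc, N.conj_σ_bot, ← mul_assoc, ← pow_add]
      rfl
  rw [mul_inv_eq_iff_eq_mul, h1, ω_coe]
  have h5 : g.right (D.σ (D.bot h)) = D.σ (D.bot h) ^ (botExp g.right h).val := aut_σ_bot _ h
  apply SemidirectProduct.ext
  · simp only [SemidirectProduct.mul_left, SemidirectProduct.left_inl,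
      SemidirectProduct.right_inl, e₁, MonoidHom.id_apply, MulAut.one_apply]
    rw [h5, h4]
    congr 1
    apply σ_bot_pow_congr
    simp
  · rw [SemidirectProduct.mul_right, SemidirectProduct.mul_right, SemidirectProduct.right_inl]
    simp [e₁]

theorem e₂_eq {j : ℕ} (h : j + 1 ∈ D.I) :
    D.e₂ h = ⟨D.σ (D.bot h), (MulAut.conj (D.σ (D.bot h)))⁻¹⟩ := by
  have h1 : (1 : ZMod (D.p (D.bot h))) - D.kmod h ≠ 0 := sub_ne_zero.2 (kmod_ne_one h).symm
  have h2 : ((D.k (j + 1) : ℕ) : ZMod (D.p (D.bot h))) = D.kmod h := rfl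
  rw [e₂]
  congr 1
  rw [zpow_sub_one, zpow_natCast, mul_inv_eq_iff_eq_mul, eq_inv_mul_iff_mul_eq, θ, ← map_pow,
    ← map_mul, ← pow_mul, ← pow_succ']
  congr 1
  apply σ_bot_pow_congr
  push_cast
  rw [ZMod.natCast_zmod_val, h2]
  field_simp
  ring

/-- Conjugation by `g` raises `e₂` to the power given by the second diagonal entry of `ω g`. -/
theorem conj_e₂ {j : ℕ} (h : j + 1 ∈ D.I) (g : Hol D.N) :
    g * D.e₂ h * g⁻¹ =
      D.e₂ h ^ ((D.ω h g : Matrix (Fin 2) (Fin 2) (ZMod (D.p (D.bot h)))) 1 1).val := by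
  have h1 : ∀ n : ℕ, D.e₂ h ^ n =
      ⟨D.σ (D.bot h) ^ n, (MulAut.conj (D.σ (D.bot h) ^ n))⁻¹⟩ := by
    intro n
    induction n with
    | zero =>
      rw [pow_zero, pow_zero, map_one, inv_one]
      rfl
    | succ n ih =>
      rw [pow_succ, ih, e₂_eq]
      apply SemidirectProduct.ext
      · simp only [SemidirectProduct.mul_left, MonoidHom.id_apply, ← map_inv, MulAut.conj_apply]
        group
      · simp only [SemidirectProduct.mul_right, ← map_inv, ← map_mul]
        congr 1
        group
  rw [mul_inv_eq_iff_eq_mul, h1, ω_coe]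
  have h5 : g.right (D.σ (D.bot h)) = D.σ (D.bot h) ^ (botExp g.right h).val := aut_σ_bot _ h
  simp only [Matrix.of_apply, Matrix.cons_val_one, Matrix.cons_val_fin_one]
  rw [← h5, e₂_eq]
  apply SemidirectProduct.ext
  · simp only [SemidirectProduct.mul_left, MonoidHom.id_apply, ← map_inv, MulAut.conj_apply]
    simp [mul_assoc]
  · simp only [SemidirectProduct.mul_right, ← map_inv]
    ext1 x
    simp [MulAut.mul_apply]

/-- The matrix `S i = diag(k i, 1)`, for `i = j + 1 ∈ I`. -/
def S (D : CunninghamData) {j : ℕ} (h : j + 1 ∈ D.I) : GL (Fin 2) (ZMod (D.p (D.bot h))) :=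
  Matrix.GeneralLinearGroup.mkOfDetNeZero !![D.kmod h, 0; 0, 1]
    (by simpa using kmod_ne_zero h)

/-- The matrix `A i = diag(k i, k i)`, for `i = j + 1 ∈ I`. -/
def A (D : CunninghamData) {j : ℕ} (h : j + 1 ∈ D.I) : GL (Fin 2) (ZMod (D.p (D.bot h))) :=
  Matrix.GeneralLinearGroup.mkOfDetNeZero !![D.kmod h, 0; 0, D.kmod h]
    (by simpa using kmod_ne_zero h)

/-- `ω` sends `σ i` to `S i`, for `i = j + 1 ∈ I`. -/
theorem ω_σ_top {j : ℕ} (h : j + 1 ∈ D.I) :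
    D.ω h (SemidirectProduct.inl (D.σ (D.top h))) = D.S h := by
  apply Units.ext
  rw [ω_coe, SemidirectProduct.left_inl, SemidirectProduct.right_inl, botExp_one, σ_top_twist,
    mul_one]
  rfl

/-- `ω` sends the automorphism `φ i` (given by `σ (i - 1) ↦ σ (i - 1) ^ k i`, with all other
generators fixed) to `A i`, for `i = j + 1 ∈ I`. -/
theorem ω_φ {j : ℕ} (h : j + 1 ∈ D.I) (φ : MulAut D.N)
    (hφ : φ (D.σ (D.bot h)) = D.σ (D.bot h) ^ D.k (j + 1)) :
    D.ω h (SemidirectProduct.inr φ) = D.A h := by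
  apply Units.ext
  have h1 : botExp φ h = D.kmod h := by
    rw [botExp, hφ, σ_bot_pow_coord, σ_coord_self, mul_one]
    rfl
  rw [ω_coe, SemidirectProduct.left_inr, SemidirectProduct.right_inr, N.twist_one, one_mul, h1]
  rfl

end CunninghamData

/-! ### Coordinates, twists and the shape of automorphisms of `N`. -/

namespace CunninghamData

variable {D : CunninghamData}

/-! Put q = p_{i-1} and P = P_{i-1} = ⟨e₁, e₂⟩. In each coordinate `a`, an automorphism of N is a
scaling plus a coboundary (`exists_aut_coord`), so Hol(N) has commuting characters `scale a`. Since
p_a - 1 = 2 p_{a+1} along the chain, q divides p_a - 1 only for a = i-2. Hence a q-element can scale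
only that coordinate, and one that scales none lies in P (`eq_e₁_pow_mul_e₂_pow`).

The hypothesis on π gives g ∈ M scaling coordinate i-2 as α does. On that coordinate g is an affine
map with a fixed point. Its commutator with an element of M moving that point is a nonzero
translation, and a suitable power of it is a power of σ_{i-2}; so M contains the translations by
σ_{i-2} (`inl_σ_mem`). Conjugating the q-part of g by such a translation makes it commute with α,
and dividing by α leaves a q-element without scalings. So αv ∈ M for some v ∈ P
(`exists_α_mul_mem`), and it follows that ⟨α, e₁, e₂⟩ ∩ M is a Sylow q-subgroup of M
(`isSylowIn_closure_inf`).

Transitivity provides an element of M with left part σ_i, on which the diagonal entries of ω have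
ratio k_i ≠ 1. Therefore M ∩ P is spanned by its intersections with the two axes
(`e₁_zpow_mem_and_e₂_zpow_mem`). Moreover ω(M) fixes v modulo M ∩ P (`zpow_sub_one_mem`): a
component of v along an axis not contained in M forces the corresponding diagonal entry to be 1 on
all of M. This yields ω(M) = ⟨S_i⟩ or ⟨S_i A_i⁻¹⟩, and the ratio k_i ≠ 1 excludes both at once. What
remains is the list of the theorem together with ⟨α⟩. The latter is impossible: α fixes 1 ∈ N and q
divides |N|, so q² divides |M| (`Hol.IsTransitive.not_isSylowIn_closure_inr`). -/

theorem N.twist_congr {x y : D.N} {a : D.Idx}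
    (h : ∀ h : (a : ℕ) + 1 ∈ D.I, x.coord (D.top h) = y.coord (D.top h)) :
    x.twist a = y.twist a := by
  by_cases ha : (a : ℕ) + 1 ∈ D.I
  · have h1 := x.twist_bot ha
    rw [h ha, ← y.twist_bot ha] at h1
    exact h1
  · rw [N.twist_of_notMem _ _ ha, N.twist_of_notMem _ _ ha]

theorem twist_aut_apply (f : MulAut D.N) (x : D.N) (a : D.Idx) : (f x).twist a = x.twist a := by
  by_cases ha : (a : ℕ) + 1 ∈ D.I
  · exact twist_aut f x ha
  · rw [N.twist_of_notMem _ _ ha, N.twist_of_notMem _ _ ha]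

theorem σ_twist_self (a : D.Idx) : (D.σ a).twist a = 1 :=
  N.twist_of_coord_eq_zero _ _ fun _ => σ_coord_of_ne fun h => by
    have := congrArg Subtype.val h
    simp at this

theorem σ_pow_coord (a b : D.Idx) (n : ℕ) : (D.σ a ^ n).coord b = n * (D.σ a).coord b := by
  induction n with
  | zero => simp [N.one_coord]
  | succ n ih =>
    rw [pow_succ, N.mul_coord, ih]
    by_cases hb : b = a
    · subst hb
      have : ∀ n : ℕ, (D.σ b ^ n).twist b = 1 := fun n => by
        induction n with
        | zero => rw [pow_zero, N.twist_one]
        | succ n ih => rw [pow_succ, N.twist_mul, ih, σ_twist_self, one_mul]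
      rw [this]
      push_cast
      ring
    · rw [σ_coord_of_ne hb]
      ring

theorem σ_pow_coord_self (a : D.Idx) (n : ℕ) : (D.σ a ^ n).coord a = n := by
  rw [σ_pow_coord, σ_coord_self, mul_one]

theorem σ_pow_coord_of_ne {a b : D.Idx} (h : b ≠ a) (n : ℕ) : (D.σ a ^ n).coord b = 0 := by
  rw [σ_pow_coord, σ_coord_of_ne h, mul_zero]

theorem σ_pow_eq_one (a : D.Idx) : D.σ a ^ D.p a = 1 := by
  ext b
  by_cases h : b = a
  · subst h
    rw [σ_pow_coord_self, N.one_coord, ZMod.natCast_self]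
  · rw [σ_pow_coord_of_ne h, N.one_coord]

theorem eq_σ_pow {x : D.N} {a : D.Idx} (h : ∀ b, b ≠ a → x.coord b = 0) :
    x = D.σ a ^ (x.coord a).val := by
  ext b
  by_cases hb : b = a
  · subst hb
    rw [σ_pow_coord_self, ZMod.natCast_zmod_val]
  · rw [h b hb, σ_pow_coord_of_ne hb]

theorem σ_pow_twist_of_notMem {a : D.Idx} (ha : (a : ℕ) ∉ D.I) (n : ℕ) (b : D.Idx) :
    (D.σ a ^ n).twist b = 1 :=
  N.twist_of_coord_eq_zero _ _ fun hb => σ_pow_coord_of_ne (fun h => ha (by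
    rw [← congrArg Subtype.val h]; exact hb)) n

theorem closure_range_σ : Subgroup.closure (Set.range D.σ) = ⊤ := by
  classical
  refine (Subgroup.eq_top_iff' _).2 fun x => ?_
  suffices h : ∀ (S : Finset D.Idx) (x : D.N), (∀ a, a ∉ S → x.coord a = 0) →
      x ∈ Subgroup.closure (Set.range D.σ) from
    h Finset.univ x fun a ha => absurd (Finset.mem_univ a) ha
  intro S
  induction S using Finset.induction_on with
  | empty =>
    intro x hx
    have : x = 1 := N.ext (funext fun a => hx a (Finset.notMem_empty a))
    rw [this]
    exact one_mem _
  | insert a S ha ih =>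
    intro x hx
    -- Right multiplication by a power of `σ a` changes only coordinate `a`; this exponent makes it
    -- zero.
    have hσ : D.σ a ^ ((-((x.twist a)⁻¹ * x.coord a)).val) ∈ Subgroup.closure (Set.range D.σ) :=
      pow_mem (Subgroup.subset_closure (Set.mem_range_self a)) _
    refine (Subgroup.mul_mem_cancel_right _ hσ).1 (ih _ fun b hb => ?_)
    rw [N.mul_coord]
    by_cases hba : b = a
    · subst hba
      have := x.twist_ne_zero b
      rw [σ_pow_coord_self, ZMod.natCast_zmod_val]
      field_simp
      ring
    · rw [σ_pow_coord_of_ne hba, mul_zero, add_zero]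
      exact hx b (by simp [hba, hb])

/-- Crossed homomorphisms for the action of `N` by the factors `twist a` are determined by their
values on the generators. -/
theorem crossed_ext {a : D.Idx} {F G : D.N → ZMod (D.p a)}
    (hF : ∀ x y, F (x * y) = F x + x.twist a * F y)
    (hG : ∀ x y, G (x * y) = G x + x.twist a * G y)
    (h : ∀ b, F (D.σ b) = G (D.σ b)) (x : D.N) : F x = G x := by
  have one : ∀ F : D.N → ZMod (D.p a), (∀ x y, F (x * y) = F x + x.twist a * F y) → F 1 = 0 := by
    intro F hF
    have := hF 1 1
    rw [mul_one, N.twist_one] at this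
    linear_combination -this
  have inv : ∀ F : D.N → ZMod (D.p a), (∀ x y, F (x * y) = F x + x.twist a * F y) →
      ∀ x, F x⁻¹ = -(x⁻¹.twist a * F x) := by
    intro F hF x
    have := hF x⁻¹ x
    rw [inv_mul_cancel, one F hF] at this
    linear_combination -this
  have hx : x ∈ Subgroup.closure (Set.range D.σ) := by
    rw [closure_range_σ]
    trivial
  induction hx using Subgroup.closure_induction with
  | mem x hx =>
    obtain ⟨b, rfl⟩ := hx
    exact h b
  | one => rw [one F hF, one G hG]
  | mul x y _ _ hx hy => rw [hF, hG, hx, hy]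
  | inv x _ hx => rw [inv F hF, inv G hG, hx]

/-- `F` is additive on the powers of `σ b`, whose order `p b` is invertible modulo `p a`. -/
theorem crossed_σ_eq_zero {a b : D.Idx} {F : D.N → ZMod (D.p a)}
    (hF : ∀ x y, F (x * y) = F x + x.twist a * F y) (hab : b ≠ a)
    (hb : (D.σ b).twist a = 1) : F (D.σ b) = 0 := by
  have h1 : F 1 = 0 := by
    have := hF 1 1
    rw [mul_one, N.twist_one] at this
    linear_combination -this
  have hn : ∀ n : ℕ, F (D.σ b ^ n) = n * F (D.σ b) := by
    intro n
    induction n with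
    | zero => simp [h1]
    | succ n ih =>
      rw [pow_succ', hF, ih, hb]
      push_cast
      ring
  have := hn (D.p b)
  rw [σ_pow_eq_one, h1] at this
  exact (mul_eq_zero.1 this.symm).resolve_left (natCast_p_ne_zero hab)

/-- Every automorphism of `N` acts on each coordinate by a scaling and a coboundary. -/
theorem exists_aut_coord (f : MulAut D.N) (a : D.Idx) : ∃ w : ZMod (D.p a), ∀ x : D.N,
    (f x).coord a = (f (D.σ a)).coord a * x.coord a + w * (1 - x.twist a) := by
  have hF : ∀ x y, (f (x * y)).coord a = (f x).coord a + x.twist a * (f y).coord a := by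
    intro x y
    rw [map_mul, N.mul_coord, twist_aut_apply]
  have hG : ∀ w : ZMod (D.p a), ∀ x y : D.N,
      (f (D.σ a)).coord a * (x * y).coord a + w * (1 - (x * y).twist a) =
      ((f (D.σ a)).coord a * x.coord a + w * (1 - x.twist a)) +
        x.twist a * ((f (D.σ a)).coord a * y.coord a + w * (1 - y.twist a)) := by
    intro w x y
    rw [N.mul_coord, N.twist_mul]
    ring
  have hne : ∀ b, b ≠ a → (D.σ b).twist a = 1 → ∀ w : ZMod (D.p a), (f (D.σ b)).coord a =
      (f (D.σ a)).coord a * (D.σ b).coord a + w * (1 - (D.σ b).twist a) := by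
    intro b hb ht w
    rw [crossed_σ_eq_zero (F := fun x => (f x).coord a) hF hb ht, ht, σ_coord_of_ne hb.symm]
    ring
  have hself : ∀ w : ZMod (D.p a), (f (D.σ a)).coord a =
      (f (D.σ a)).coord a * (D.σ a).coord a + w * (1 - (D.σ a).twist a) := by
    intro w
    rw [σ_coord_self, σ_twist_self]
    ring
  by_cases ha : (a : ℕ) + 1 ∈ D.I
  · obtain ⟨κ, ht, hk⟩ : ∃ κ : ZMod (D.p a), (D.σ (D.top ha)).twist a = κ ∧ 1 - κ ≠ 0 :=
      ⟨D.kmod ha, σ_top_twist ha, sub_ne_zero.2 (kmod_ne_one ha).symm⟩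
    -- The only generator with nontrivial twist at `a` is `σ (a + 1)`; this is the coboundary with
    -- the right value there.
    set w := (f (D.σ (D.top ha))).coord a * (1 - κ)⁻¹ with hw
    refine ⟨w, crossed_ext (F := fun x => (f x).coord a)
      (G := fun x => (f (D.σ a)).coord a * x.coord a + w * (1 - x.twist a)) hF (hG _) fun b => ?_⟩
    by_cases hba : b = a
    · subst hba
      exact hself _
    by_cases hb : b = D.top ha
    · subst hb
      simp only [ht, σ_coord_of_ne (Ne.symm hba), hw, mul_assoc]
      rw [inv_mul_cancel₀ hk]
      ring
    · exact hne b hba (N.twist_of_coord_eq_zero _ _ fun _ => σ_coord_of_ne (Ne.symm hb)) _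
  · refine ⟨0, crossed_ext (F := fun x => (f x).coord a)
      (G := fun x => (f (D.σ a)).coord a * x.coord a + 0 * (1 - x.twist a)) hF (hG _) fun b => ?_⟩
    by_cases hba : b = a
    · subst hba
      exact hself _
    · exact hne b hba (N.twist_of_notMem _ _ ha) _

theorem aut_coord_of_notMem (f : MulAut D.N) {a : D.Idx} (ha : (a : ℕ) + 1 ∉ D.I) (x : D.N) :
    (f x).coord a = (f (D.σ a)).coord a * x.coord a := by
  obtain ⟨w, hw⟩ := exists_aut_coord f a
  rw [hw, N.twist_of_notMem _ _ ha]
  ring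

/-- The factor by which the automorphism part of an element of `Hol(N)` acts on the exponent of
`σ a`. -/
def scale (D : CunninghamData) (a : D.Idx) : Hol D.N →* (ZMod (D.p a))ˣ :=
  (MonoidHom.toHomUnits
    { toFun := fun f : MulAut D.N => (f (D.σ a)).coord a
      map_one' := σ_coord_self a
      map_mul' := fun f g => by
        obtain ⟨w, hw⟩ := exists_aut_coord f a
        rw [MulAut.mul_apply, hw, twist_aut_apply, σ_twist_self]
        ring }).comp SemidirectProduct.rightHom

theorem scale_coe (a : D.Idx) (g : Hol D.N) :
    (D.scale a g : ZMod (D.p a)) = (g.right (D.σ a)).coord a := rfl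

theorem scale_inl (a : D.Idx) (x : D.N) : D.scale a (SemidirectProduct.inl x) = 1 := by
  apply Units.ext
  rw [scale_coe, SemidirectProduct.right_inl]
  exact σ_coord_self a

theorem right_coord_of_notMem (g : Hol D.N) {a : D.Idx} (ha : (a : ℕ) + 1 ∉ D.I) (x : D.N) :
    (g.right x).coord a = D.scale a g * x.coord a := aut_coord_of_notMem g.right ha x

theorem left_mul_coord (g h : Hol D.N) {a : D.Idx} (ha : (a : ℕ) + 1 ∉ D.I) :
    (g * h).left.coord a = g.left.coord a + D.scale a g * h.left.coord a := by
  rw [SemidirectProduct.mul_left, MonoidHom.id_apply, N.mul_coord, N.twist_of_notMem _ _ ha,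
    right_coord_of_notMem g ha, one_mul]

theorem left_pow_coord (g : Hol D.N) {a : D.Idx} (ha : (a : ℕ) + 1 ∉ D.I) (hg : D.scale a g = 1)
    (n : ℕ) : (g ^ n).left.coord a = n * g.left.coord a := by
  induction n with
  | zero => simp [N.one_coord]
  | succ n ih =>
    rw [pow_succ', left_mul_coord _ _ ha, ih, hg]
    push_cast
    ring

/-- Automorphisms preserve twists, so without scaling the coboundary parameters add up under
iteration. -/
theorem right_pow_coord (g : Hol D.N) {a : D.Idx} (hg : D.scale a g = 1) :
    ∃ w : ZMod (D.p a), ∀ (n : ℕ) (x : D.N),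
      ((g ^ n).right x).coord a = x.coord a + n * w * (1 - x.twist a) := by
  obtain ⟨w, hw⟩ := exists_aut_coord g.right a
  rw [← scale_coe, hg] at hw
  refine ⟨w, fun n => ?_⟩
  induction n with
  | zero => simp
  | succ n ih =>
    intro x
    rw [pow_succ', SemidirectProduct.mul_right, MulAut.mul_apply, hw, ih]
    have : ((g ^ n).right x).twist a = x.twist a := twist_aut_apply _ _ _
    rw [this]
    push_cast
    ring

theorem natCast_pow_p_ne_zero {a b : D.Idx} (h : a ≠ b) (n : ℕ) :
    ((D.p a ^ n : ℕ) : ZMod (D.p b)) ≠ 0 := by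
  rw [Nat.cast_pow]
  exact pow_ne_zero _ (natCast_p_ne_zero h)

/-- An element of `p a`-power order of `Hol(N)`, where `a ∉ I`, with all scalings trivial, acts
nontrivially only on the coordinate `a`. -/
theorem coord_eq_of_pow_eq_one {a : D.Idx} (ha : (a : ℕ) ∉ D.I) {g : Hol D.N}
    (hg : ∀ b, D.scale b g = 1) {n : ℕ} (hn : g ^ D.p a ^ n = 1) {b : D.Idx} (hb : b ≠ a) :
    g.left.coord b = 0 ∧ ∀ x, (g.right x).coord b = x.coord b := by
  have hzero : ∀ b : D.Idx, b ≠ a → (b : ℕ) + 1 ∉ D.I → g.left.coord b = 0 := by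
    intro b hb hb'
    have := left_pow_coord g hb' (hg b) (D.p a ^ n)
    rw [hn, SemidirectProduct.one_left, N.one_coord] at this
    exact (mul_eq_zero.1 this.symm).resolve_left (natCast_pow_p_ne_zero hb.symm n)
  -- The twist at `b` is governed by coordinate b + 1 ∈ I. This index differs from `a` ∉ I, and b +
  -- 2 ∉ I by sparsity, so `hzero` covers it.
  have htw : ∀ b, g.left.twist b = 1 := fun b =>
    N.twist_of_coord_eq_zero _ _ fun h => hzero _ (fun h' => ha (h' ▸ h)) (D.I_sparse _ h)
  obtain ⟨w, hw⟩ := right_pow_coord g (hg b)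
  constructor
  -- As the left part has no twist, the coboundary term of `g.right` vanishes on it and the powers
  -- are linear in every coordinate.
  · have hL : ∀ n : ℕ, (g ^ n).left.coord b = n * g.left.coord b ∧ (g ^ n).left.twist b = 1 := by
      intro n
      induction n with
      | zero => simp [N.one_coord, N.twist_one]
      | succ n ih =>
        rw [pow_succ, SemidirectProduct.mul_left, MonoidHom.id_apply, N.mul_coord, N.twist_mul,
          twist_aut_apply, htw, ih.1, ih.2, hw, htw]
        constructor
        · push_cast
          ring
        · ring
    have := (hL (D.p a ^ n)).1
    rw [hn, SemidirectProduct.one_left, N.one_coord] at this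
    exact (mul_eq_zero.1 this.symm).resolve_left (natCast_pow_p_ne_zero hb.symm n)
  · intro x
    have h1 := hw (D.p a ^ n) x
    rw [hn, SemidirectProduct.one_right, MulAut.one_apply] at h1
    have h2 : ((D.p a ^ n : ℕ) : ZMod (D.p b)) * (w * (1 - x.twist b)) = 0 := by
      linear_combination -h1
    have h3 := (mul_eq_zero.1 h2).resolve_left (natCast_pow_p_ne_zero hb.symm n)
    have h4 := hw 1 x
    rw [pow_one] at h4
    rw [h4, Nat.cast_one]
    linear_combination h3

instance : Finite D.N :=
  Finite.of_injective (fun x : D.N => x.coord) fun _ _ h => N.ext h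

instance : Finite (MulAut D.N) :=
  Finite.of_injective (fun f : MulAut D.N => (f : D.N → D.N)) DFunLike.coe_injective

instance : Finite (Hol D.N) := Finite.of_equiv _ SemidirectProduct.equivProd.symm

end CunninghamData

/-! ### Powers modulo a prime. -/

/-- Choose `e` by the Chinese remainder theorem, divisible by the prime-to-p part of |G|. The
congruence e ≡ 1 means that passing to `g ^ e` leaves data living modulo `p` unchanged. -/
theorem exists_pow_prime_pow_eq_one {G : Type*} [Group G] [Finite G] {p : ℕ} (hp : p.Prime)
    (g : G) : ∃ e n : ℕ, (g ^ e) ^ p ^ n = 1 ∧ e ≡ 1 [MOD p] := by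
  obtain ⟨n, m, hm, hc⟩ := Nat.exists_eq_pow_mul_and_not_dvd (Nat.card_pos (α := G)).ne' p
    hp.ne_one
  obtain ⟨e, h1, h2⟩ := Nat.chineseRemainder ((Nat.Prime.coprime_iff_not_dvd hp).2 hm) 1 0
  refine ⟨e, n, ?_, h1⟩
  obtain ⟨d, rfl⟩ := (Nat.modEq_zero_iff_dvd).1 h2
  have : m * d * p ^ n = Nat.card G * d := by rw [hc]; ring
  rw [← pow_mul, this, pow_mul, pow_card_eq_one', one_pow]

/-- By Bézout, `n` is invertible modulo `q`. -/
theorem mem_of_zpow_mem {G : Type*} [Group G] {q : ℕ} (hq : q.Prime) {e : G} (he : e ^ q = 1)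
    {M : Subgroup G} {n : ℤ} (hn : ¬ (q : ℤ) ∣ n) (h : e ^ n ∈ M) : e ∈ M := by
  obtain ⟨u, v, huv⟩ := (((Nat.prime_iff_prime_int.1 hq).coprime_iff_not_dvd).2 hn)
  have : e = (e ^ n) ^ v := by
    rw [← zpow_mul]
    conv_lhs => rw [← zpow_one e, ← huv, zpow_add, mul_comm u, zpow_mul, zpow_natCast, he,
      one_zpow, one_mul, mul_comm]
  rw [this]
  exact zpow_mem h v

theorem zpow_eq_one_of_dvd {G : Type*} [Group G] {q : ℕ} {e : G} (he : e ^ q = 1) {n : ℤ}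
    (hn : (q : ℤ) ∣ n) : e ^ n = 1 := by
  obtain ⟨d, rfl⟩ := hn
  rw [zpow_mul, zpow_natCast, he, one_zpow]

/-! ### Elements of prime power order in Hol(N). -/

namespace CunninghamData

variable {D : CunninghamData}

theorem eq_of_p_eq {a b : D.Idx} (h : D.p a = D.p b) : a = b := by
  by_contra hab
  exact natCast_p_ne_zero hab (by rw [h, ZMod.natCast_self])

/-- For a < l one has p_a - 1 = 2 p_{a+1}, whose only odd prime factor is p_{a+1}. For a = l, every
prime of the chain exceeds p_l - 1. -/
theorem succ_eq_of_dvd_p_sub_one {a b : D.Idx} (h : D.p b ∣ D.p a - 1) : (a : ℕ) + 1 = b := by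
  have ha := Finset.mem_Icc.1 a.2
  have hb := Finset.mem_Icc.1 b.2
  have hpb := D.prime_p b b.2
  have hpa := (D.prime_p a a.2).two_le
  by_cases hal : (a : ℕ) + 1 ≤ D.l
  · have ha1 : (a : ℕ) + 1 ∈ Finset.Icc 1 D.l := Finset.mem_Icc.2 ⟨by omega, hal⟩
    rw [D.chain a ha.1 hal, Nat.add_sub_cancel] at h
    rcases (hpb.dvd_mul).1 h with h | h
    · have := Nat.le_of_dvd (by norm_num) h
      obtain ⟨t, ht⟩ := D.odd_p b b.2
      have := hpb.two_le
      omega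
    · rw [Nat.prime_dvd_prime_iff_eq hpb (D.prime_p _ ha1)] at h
      exact (congrArg Subtype.val (eq_of_p_eq (a := b) (b := ⟨a + 1, ha1⟩) h)).symm
  · exfalso
    have h1 := Nat.le_of_dvd (by omega) h
    rcases lt_or_eq_of_le (show (b : ℕ) ≤ a by omega) with h2 | h2
    · have := D.p_lt hb.1 h2 ha.2
      omega
    · rw [h2] at h1
      omega

/-- The scaling lies in a group of order p_a - 1, which is prime to p_b unless b = a + 1. -/
theorem scale_eq_one_of_pow_eq_one {a b : D.Idx} (h : (a : ℕ) + 1 ≠ b) {g : Hol D.N} {n : ℕ}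
    (hn : g ^ D.p b ^ n = 1) : D.scale a g = 1 := by
  have h1 : D.scale a g ^ (D.p b ^ n) = 1 := by rw [← map_pow, hn, map_one]
  have h2 : D.scale a g ^ (D.p a - 1) = 1 := ZMod.units_pow_card_sub_one_eq_one _ _
  have h3 : Nat.Coprime (D.p b ^ n) (D.p a - 1) :=
    Nat.Coprime.pow_left _ (((D.prime_p b b.2).coprime_iff_not_dvd).2 fun h' =>
      h (succ_eq_of_dvd_p_sub_one h'))
  have := pow_gcd_eq_one.2 ⟨h1, h2⟩
  rwa [h3, pow_one] at this

theorem σ_pow_congr (a : D.Idx) {m n : ℕ} (h : (m : ZMod (D.p a)) = n) :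
    D.σ a ^ m = D.σ a ^ n :=
  pow_eq_pow_of_modEq ((ZMod.natCast_eq_natCast_iff _ _ _).1 h) (σ_pow_eq_one a)

/-- If a transitive subgroup contains an element acting nontrivially on the central factor
`⟨σ j⟩`, then it contains the translations by this factor. -/
theorem inl_σ_mem {j : D.Idx} (hj : D.InCm j) {M : Subgroup (Hol D.N)}
    (hM : Hol.IsTransitive M) {g : Hol D.N} (hg : g ∈ M) (hgj : D.scale j g ≠ 1) :
    SemidirectProduct.inl (D.σ j) ∈ M := by
  set u : ZMod (D.p j) := (D.scale j g : ZMod (D.p j)) with hu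
  have hu1 : 1 - u ≠ 0 := fun h => hgj (Units.ext (sub_eq_zero.1 h).symm)
  -- `z` is the fixed point of the affine map t ↦ `g.left.coord j` + u t that `g` induces on
  -- coordinate `j`.
  set z : ZMod (D.p j) := g.left.coord j * (1 - u)⁻¹ with hz
  have hz' : g.left.coord j = (1 - u) * z := by
    rw [hz]
    field_simp
  -- Transitivity gives `x` carrying z to z + 1. As `x` does not fix `z`, its commutator with `g` is
  -- a nonzero translation on coordinate `j`.
  obtain ⟨x, hx, hxz⟩ := hM (D.σ j ^ z.val) (D.σ j ^ (z + 1).val)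
  have hxz' := congrArg (fun y => N.coord y j) hxz
  simp only [N.mul_coord, N.twist_of_notMem _ _ hj.2, one_mul, σ_pow_coord_self,
    right_coord_of_notMem x hj.2, ZMod.natCast_zmod_val] at hxz'
  obtain ⟨y, hy⟩ : ∃ y, y = g * x * g⁻¹ * x⁻¹ := ⟨_, rfl⟩
  have hyM : y ∈ M := hy ▸ mul_mem (mul_mem (mul_mem hg hx) (inv_mem hg)) (inv_mem hx)
  have hys : ∀ a, D.scale a y = 1 := fun a => by
    rw [hy, map_mul, map_mul, map_mul, map_inv, map_inv, mul_right_comm (D.scale a g),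
      mul_inv_cancel, one_mul, mul_inv_cancel]
  have hyj : y.left.coord j = u - 1 := by
    have h1 : y * (x * g) = g * x := by rw [hy]; group
    have h2 := left_mul_coord y (x * g) hj.2
    rw [h1, left_mul_coord _ _ hj.2, left_mul_coord _ _ hj.2, hys, Units.val_one, ← hu, hz'] at h2
    linear_combination -h2 + (u - 1) * hxz'
  -- The p_j-part keeps the translation, because e ≡ 1 modulo p_j, and is trivial in every other
  -- coordinate.
  obtain ⟨e, n, hn, he⟩ := exists_pow_prime_pow_eq_one (D.prime_p j j.2) y
  have hyes : ∀ a, D.scale a (y ^ e) = 1 := fun a => by rw [map_pow, hys, one_pow]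
  have hyej : (y ^ e).left.coord j = u - 1 := by
    rw [left_pow_coord _ hj.2 (hys j), hyj, (ZMod.natCast_eq_natCast_iff _ _ _).2 he,
      Nat.cast_one, one_mul]
  have hye : y ^ e = SemidirectProduct.inl (D.σ j) ^ (u - 1).val := by
    rw [← map_pow]
    apply SemidirectProduct.ext
    · rw [SemidirectProduct.left_inl, ← hyej]
      exact eq_σ_pow fun b hb => (coord_eq_of_pow_eq_one hj.1 hyes hn hb).1
    · rw [SemidirectProduct.right_inl]
      ext x b
      rw [MulAut.one_apply]
      by_cases hb : b = j
      · subst hb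
        rw [right_coord_of_notMem _ hj.2, hyes, Units.val_one, one_mul]
      · exact (coord_eq_of_pow_eq_one hj.1 hyes hn hb).2 x
  refine mem_of_zpow_mem (D.prime_p j j.2) (n := ((u - 1).val : ℤ)) ?_ ?_ ?_
  · rw [← map_pow, σ_pow_eq_one, map_one]
  · intro h
    rw [← ZMod.intCast_zmod_eq_zero_iff_dvd, Int.cast_natCast, ZMod.natCast_zmod_val] at h
    exact hu1 (by linear_combination -h)
  · rw [zpow_natCast, ← hye]
    exact pow_mem hyM e

theorem e₁_pow {j : ℕ} (h : j + 1 ∈ D.I) (n : ℕ) :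
    D.e₁ h ^ n = ⟨D.σ (D.bot h) ^ n, 1⟩ :=
  (map_pow (SemidirectProduct.inl (φ := MonoidHom.id (MulAut D.N))) _ n).symm

theorem e₂_pow {j : ℕ} (h : j + 1 ∈ D.I) (n : ℕ) :
    D.e₂ h ^ n = ⟨D.σ (D.bot h) ^ n, (MulAut.conj (D.σ (D.bot h) ^ n))⁻¹⟩ := by
  induction n with
  | zero =>
    rw [pow_zero, pow_zero, map_one, inv_one]
    rfl
  | succ n ih =>
    rw [pow_succ, ih, e₂_eq]
    apply SemidirectProduct.ext
    · simp only [SemidirectProduct.mul_left, MonoidHom.id_apply, ← map_inv, MulAut.conj_apply]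
      group
    · simp only [SemidirectProduct.mul_right, ← map_inv, ← map_mul]
      congr 1
      group

theorem e₁_pow_p {j : ℕ} (h : j + 1 ∈ D.I) : D.e₁ h ^ D.p j = 1 := by
  rw [e₁_pow, show D.σ (D.bot h) ^ D.p j = 1 from σ_pow_eq_one (D.bot h)]
  rfl

theorem e₂_pow_p {j : ℕ} (h : j + 1 ∈ D.I) : D.e₂ h ^ D.p j = 1 := by
  rw [e₂_pow, show D.σ (D.bot h) ^ D.p j = 1 from σ_pow_eq_one (D.bot h), map_one, inv_one]
  rfl

theorem e₁_pow_mul_e₂_pow {j : ℕ} (h : j + 1 ∈ D.I) (m n : ℕ) :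
    D.e₁ h ^ m * D.e₂ h ^ n =
      ⟨D.σ (D.bot h) ^ (m + n), (MulAut.conj (D.σ (D.bot h) ^ n))⁻¹⟩ := by
  rw [e₁_pow, e₂_pow]
  apply SemidirectProduct.ext
  · exact (pow_add _ _ _).symm
  · exact one_mul _

theorem commute_e₁_e₂ {j : ℕ} (h : j + 1 ∈ D.I) : Commute (D.e₁ h) (D.e₂ h) := by
  rw [e₂_eq]
  apply SemidirectProduct.ext
  · simp [SemidirectProduct.mul_left, e₁]
  · simp [SemidirectProduct.mul_right, e₁]

/-- A `p (i - 1)`-element of `Hol(N)` with all scalings trivial lies in `P (i - 1)`. -/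
theorem eq_e₁_pow_mul_e₂_pow {j : ℕ} (h : j + 1 ∈ D.I) {g : Hol D.N}
    (hg : ∀ b, D.scale b g = 1) {n : ℕ} (hn : g ^ D.p j ^ n = 1) :
    ∃ m n : ℕ, g = D.e₁ h ^ m * D.e₂ h ^ n := by
  have hj : ((D.bot h : D.Idx) : ℕ) ∉ D.I := fun h' => D.I_sparse _ h' h
  have hc := fun b hb => coord_eq_of_pow_eq_one (a := D.bot h) hj hg hn (b := b) hb
  obtain ⟨w, hw⟩ := exists_aut_coord g.right (D.bot h)
  rw [← scale_coe, hg, Units.val_one] at hw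
  -- The coboundary with parameter `w` is conjugation by σ_{i-1}^w, while e₁^m e₂^n has left part
  -- σ_{i-1}^(m+n) and acts by conjugation by σ_{i-1}^(-n).
  refine ⟨(g.left.coord (D.bot h) + w).val, (-w).val, ?_⟩
  rw [e₁_pow_mul_e₂_pow]
  apply SemidirectProduct.ext
  · refine (eq_σ_pow fun b hb => (hc b hb).1).trans (σ_pow_congr _ ?_)
    push_cast
    simp only [ZMod.natCast_zmod_val]
    ring
  · refine eq_inv_of_mul_eq_one_right ?_
    ext x b
    rw [MulAut.mul_apply, MulAut.one_apply, MulAut.conj_apply]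
    revert b
    rw [← funext_iff, ← N.ext_iff, mul_inv_eq_iff_eq_mul]
    ext b
    rw [N.mul_coord, N.mul_coord, σ_pow_twist_of_notMem hj, one_mul]
    by_cases hb : b = D.bot h
    · subst hb
      rw [hw, σ_pow_coord_self, ZMod.natCast_zmod_val]
      ring
    · rw [(hc b hb).2, σ_pow_coord_of_ne hb]
      ring

end CunninghamData

/-! ### Intersecting a subgroup with the span of three commuting elements. -/

section CommutingGenerators

variable {G : Type*} [Group G] {a e f : G}

/-- Commutativity gives a homomorphism from ℤ³, and its range contains the generators. -/
theorem exists_zpow_of_mem_closure_triple (hae : Commute a e) (haf : Commute a f)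
    (hef : Commute e f) {g : G} (hg : g ∈ Subgroup.closure {a, e, f}) :
    ∃ x m n : ℤ, g = a ^ x * e ^ m * f ^ n := by
  let φ : (Multiplicative ℤ × Multiplicative ℤ) × Multiplicative ℤ →* G :=
    ((zpowersHom G a).noncommCoprod (zpowersHom G e) fun x y => by
      simpa using (hae.zpow_zpow _ _)).noncommCoprod (zpowersHom G f) fun x y => by
        simpa using ((haf.zpow_zpow _ _).mul_left (hef.zpow_zpow _ _))
  have hφ : ∀ x m n : ℤ, φ ((Multiplicative.ofAdd x, Multiplicative.ofAdd m),
      Multiplicative.ofAdd n) = a ^ x * e ^ m * f ^ n := fun x m n => by simp [φ]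
  have h : Subgroup.closure {a, e, f} ≤ φ.range := by
    rw [Subgroup.closure_le]
    rintro x (rfl | rfl | rfl)
    · exact ⟨_, (hφ 1 0 0).trans (by simp)⟩
    · exact ⟨_, (hφ 0 1 0).trans (by simp)⟩
    · exact ⟨_, (hφ 0 0 1).trans (by simp)⟩
  obtain ⟨⟨⟨x, m⟩, n⟩, h⟩ := h hg
  exact ⟨_, _, _, h.symm.trans (hφ x.toAdd m.toAdd n.toAdd)⟩

theorem exists_zpow_of_mem_closure_pair (hae : Commute a e) {g : G}
    (hg : g ∈ Subgroup.closure {a, e}) : ∃ x m : ℤ, g = a ^ x * e ^ m := by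
  have h : Subgroup.closure {a, e} ≤ Subgroup.closure {a, e, 1} :=
    Subgroup.closure_mono (by intro x; simp +contextual [or_imp])
  obtain ⟨x, m, n, h⟩ :=
    exists_zpow_of_mem_closure_triple hae (Commute.one_right a) (Commute.one_right e) (h hg)
  exact ⟨x, m, by rw [h, one_zpow, mul_one]⟩

theorem mem_closure_triple (x m n : ℤ) : a ^ x * e ^ m * f ^ n ∈ Subgroup.closure {a, e, f} :=
  mul_mem (mul_mem (zpow_mem (Subgroup.subset_closure (by simp)) _)
    (zpow_mem (Subgroup.subset_closure (by simp)) _))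
    (zpow_mem (Subgroup.subset_closure (by simp)) _)

/-- This trades `a` for a generator a e^m f^n known to lie in `M`, so that only the remainder in ⟨e,
f⟩ must be tested for membership. -/
theorem zpow_mul_zpow_mul_zpow (hae : Commute a e) (haf : Commute a f) (hef : Commute e f)
    (m n x k l : ℤ) : a ^ x * e ^ k * f ^ l =
      (a * e ^ m * f ^ n) ^ x * (e ^ (k - m * x) * f ^ (l - n * x)) := by
  rw [((haf.zpow_right n).mul_left (hef.zpow_zpow m n)).mul_zpow, (hae.zpow_right m).mul_zpow,
    ← zpow_mul, ← zpow_mul]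
  have h1 := (hef.zpow_zpow (k - m * x) (n * x)).eq
  have h2 : e ^ k = e ^ (m * x) * e ^ (k - m * x) := by rw [← zpow_add]; congr 1; ring
  have h3 : f ^ l = f ^ (n * x) * f ^ (l - n * x) := by rw [← zpow_add]; congr 1; ring
  rw [h2, h3]
  simp only [mul_assoc]
  rw [← mul_assoc (e ^ (k - m * x)) (f ^ (n * x)), h1]
  simp only [mul_assoc]

variable {q : ℕ} {M : Subgroup G}

/-- Modulo `e` and a f^n, an element of the intersection is a power of `f` in `M`; it is trivial
since `f ^ q = 1` with `q` prime and `f` is not in `M`. -/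
theorem closure_triple_inf_of_mem_of_notMem (hq : q.Prime) (hae : Commute a e) (haf : Commute a f)
    (hef : Commute e f) (hfq : f ^ q = 1) (he : e ∈ M) (hf : f ∉ M) {n : ℤ}
    (h : a * f ^ n ∈ M) :
    Subgroup.closure {a, e, f} ⊓ M = Subgroup.closure {e, a * f ^ n} := by
  apply le_antisymm
  · rintro g ⟨hg, hgM⟩
    obtain ⟨x, k, l, rfl⟩ := exists_zpow_of_mem_closure_triple hae haf hef hg
    rw [zpow_mul_zpow_mul_zpow hae haf hef 0 n, zpow_zero, mul_one] at hgM ⊢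
    have h1 := (Subgroup.mul_mem_cancel_left _ (zpow_mem he _)).1
      ((Subgroup.mul_mem_cancel_left _ (zpow_mem h x)).1 hgM)
    have h2 : (q : ℤ) ∣ l - n * x := by
      by_contra h2
      exact hf (mem_of_zpow_mem hq hfq h2 h1)
    rw [zpow_eq_one_of_dvd hfq h2, mul_one]
    exact mul_mem (zpow_mem (Subgroup.subset_closure (by simp)) _)
      (zpow_mem (Subgroup.subset_closure (by simp)) _)
  · rw [Subgroup.closure_le]
    rintro g (rfl | rfl)
    · exact ⟨Subgroup.subset_closure (by simp), he⟩
    · exact ⟨mul_mem (Subgroup.subset_closure (by simp))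
        (zpow_mem (Subgroup.subset_closure (by simp)) _), h⟩

/-- After removal of a power of a e^m f^n, the remainder lies in ⟨e, f⟩ ∩ M; `hsep` splits it into
powers of `e` and `f` in `M`, and both are trivial. -/
theorem closure_triple_inf_of_notMem (hq : q.Prime) (hae : Commute a e) (haf : Commute a f)
    (hef : Commute e f) (heq : e ^ q = 1) (hfq : f ^ q = 1) (he : e ∉ M) (hf : f ∉ M)
    (hsep : ∀ m n : ℤ, e ^ m * f ^ n ∈ M → e ^ m ∈ M ∧ f ^ n ∈ M) {m n : ℤ}
    (h : a * e ^ m * f ^ n ∈ M) :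
    Subgroup.closure {a, e, f} ⊓ M = Subgroup.closure {a * e ^ m * f ^ n} := by
  apply le_antisymm
  · rintro g ⟨hg, hgM⟩
    obtain ⟨x, k, l, rfl⟩ := exists_zpow_of_mem_closure_triple hae haf hef hg
    rw [zpow_mul_zpow_mul_zpow hae haf hef m n] at hgM ⊢
    obtain ⟨h1, h2⟩ := hsep _ _ ((Subgroup.mul_mem_cancel_left _ (zpow_mem h x)).1 hgM)
    have h3 : (q : ℤ) ∣ k - m * x := by
      by_contra h3
      exact he (mem_of_zpow_mem hq heq h3 h1)
    have h4 : (q : ℤ) ∣ l - n * x := by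
      by_contra h4
      exact hf (mem_of_zpow_mem hq hfq h4 h2)
    rw [zpow_eq_one_of_dvd heq h3, zpow_eq_one_of_dvd hfq h4, mul_one, mul_one]
    exact zpow_mem (Subgroup.mem_closure_singleton_self _) _
  · rw [Subgroup.closure_le]
    rintro g rfl
    refine ⟨?_, h⟩
    have := mem_closure_triple (a := a) (e := e) (f := f) 1 m n
    rwa [zpow_one] at this

end CommutingGenerators

/-! ### Sylow subgroups of `M` as subgroups of the ambient group. -/

theorem IsSylowIn.le {G : Type*} [Group G] {q : ℕ} {M Q : Subgroup G} (h : IsSylowIn q M Q) :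
    Q ≤ M := by
  obtain ⟨P, rfl⟩ := h
  exact Subgroup.map_subtype_le _

theorem IsSylowIn.eq_of_le {G : Type*} [Group G] {q : ℕ} {M Q R : Subgroup G}
    (h : IsSylowIn q M Q) (hR : IsPGroup q R) (hRM : R ≤ M) (hQR : Q ≤ R) : R = Q := by
  obtain ⟨P, rfl⟩ := h
  have h1 : (P : Subgroup M) ≤ R.subgroupOf M := by
    rwa [Subgroup.map_le_iff_le_comap] at hQR
  have h2 := P.3 (hR.comap_of_injective M.subtype M.subtype_injective) h1
  have h3 : R.subgroupOf M = P := h2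
  rw [← h3, Subgroup.subgroupOf_map_subtype, inf_eq_left.2 hRM]

theorem isSylowIn_of_forall {G : Type*} [Group G] {q : ℕ} {M Q : Subgroup G} (hQM : Q ≤ M)
    (hQ : IsPGroup q Q)
    (h : ∀ R : Subgroup G, IsPGroup q R → R ≤ M → Q ≤ R → R ≤ Q) : IsSylowIn q M Q := by
  obtain ⟨P, hP⟩ := (hQ.comap_of_injective M.subtype M.subtype_injective).exists_le_sylow
  refine ⟨P, ?_⟩
  have h1 : Q ≤ (P : Subgroup M).map M.subtype := by
    have := Subgroup.map_mono (f := M.subtype) hP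
    rwa [← Subgroup.subgroupOf, Subgroup.subgroupOf_map_subtype, inf_eq_left.2 hQM] at this
  exact le_antisymm (h _ (P.isPGroup'.map _) (Subgroup.map_subtype_le _) h1) h1

/-! ### Scaling automorphisms of a central coordinate. -/

namespace CunninghamData

variable {D : CunninghamData}

theorem powAut_coord_self (j : D.Idx) (hj : D.InCm j) (u : (ZMod (D.p j))ˣ) (x : D.N) :
    (D.powAut j hj u x).coord j = u * x.coord j := Function.update_self _ _ _

theorem powAut_coord_of_ne {j a : D.Idx} (h : a ≠ j) (hj : D.InCm j) (u : (ZMod (D.p j))ˣ)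
    (x : D.N) : (D.powAut j hj u x).coord a = x.coord a := Function.update_of_ne h _ _

theorem powAut_pow (j : D.Idx) (hj : D.InCm j) (u : (ZMod (D.p j))ˣ) (n : ℕ) :
    D.powAut j hj u ^ n = D.powAut j hj (u ^ n) := by
  induction n with
  | zero =>
    ext x a
    by_cases h : a = j
    · subst h
      simp [powAut_coord_self]
    · simp [powAut_coord_of_ne h]
  | succ n ih =>
    ext x a
    rw [pow_succ, ih, MulAut.mul_apply]
    by_cases h : a = j
    · subst h
      simp only [powAut_coord_self, pow_succ, Units.val_mul]
      ring
    · simp [powAut_coord_of_ne h]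

theorem powAut_one (j : D.Idx) (hj : D.InCm j) : D.powAut j hj 1 = 1 := by
  rw [← pow_zero (1 : (ZMod (D.p j))ˣ), ← powAut_pow, pow_zero]

theorem scale_powAut_self (j : D.Idx) (hj : D.InCm j) (u : (ZMod (D.p j))ˣ) :
    D.scale j (SemidirectProduct.inr (D.powAut j hj u)) = u := by
  apply Units.ext
  rw [scale_coe, SemidirectProduct.right_inr, powAut_coord_self, σ_coord_self, mul_one]

/-- `powAut j` commutes with the elements of `Hol(N)` that fix `0` in the coordinate `j`. -/
theorem commute_powAut {j : D.Idx} (hj : D.InCm j) (u : (ZMod (D.p j))ˣ) {g : Hol D.N}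
    (hg : g.left.coord j = 0) :
    Commute (SemidirectProduct.inr (D.powAut j hj u)) g := by
  apply SemidirectProduct.ext
  · rw [SemidirectProduct.mul_left, SemidirectProduct.mul_left, SemidirectProduct.left_inr,
      SemidirectProduct.right_inr, MonoidHom.id_apply, one_mul, map_one, mul_one]
    ext a
    by_cases h : a = j
    · subst h
      rw [powAut_coord_self, hg, mul_zero]
    · rw [powAut_coord_of_ne h]
  · rw [SemidirectProduct.mul_right, SemidirectProduct.mul_right, SemidirectProduct.right_inr]
    ext x a
    rw [MulAut.mul_apply, MulAut.mul_apply]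
    by_cases h : a = j
    · subst h
      rw [powAut_coord_self, right_coord_of_notMem _ hj.2, right_coord_of_notMem _ hj.2,
        powAut_coord_self]
      ring
    · obtain ⟨w, hw⟩ := exists_aut_coord g.right a
      rw [powAut_coord_of_ne h, hw x, hw (D.powAut j hj u x), powAut_coord_of_ne h]
      congr 3
      -- Twists depend only on coordinates with index in `I`, and j ∉ I.
      refine N.twist_congr fun ha => (powAut_coord_of_ne (fun h' => hj.1 ?_) hj u x).symm
      rw [← h']
      exact ha

/-- Since σ_j lies in C_m, the restriction to C_m determines the scaling at `j`. -/
theorem exists_scale_eq_of_π {j : D.Idx} (hj : D.InCm j) {M : Subgroup (Hol D.N)} {α : Hol D.N}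
    (h : D.π α ∈ M.map D.π) : ∃ g ∈ M, D.scale j g = D.scale j α := by
  obtain ⟨g, hg, hgα⟩ := h
  refine ⟨g, hg, Units.ext ?_⟩
  have hσ : D.σ j ∈ D.Cm := fun a ha => σ_coord_of_ne fun h => ha (h ▸ hj)
  have := congrArg (fun f : MulAut D.Cm => ((f ⟨D.σ j, hσ⟩ : D.Cm) : D.N).coord j) hgα
  exact this

end CunninghamData

/-! ### The action on `N` and the exclusion of ⟨α⟩. -/

/-- The action of `Hol(N)` on `N` given by `[η, f] · x = η f(x)`. -/
abbrev Hol.mulAction (N : Type*) [Group N] : MulAction (Hol N) N where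
  smul g x := g.left * g.right x
  one_smul x := one_mul x
  mul_smul g h x := by
    change (g * h).left * (g * h).right x = g.left * g.right (h.left * h.right x)
    rw [SemidirectProduct.mul_left, SemidirectProduct.mul_right, MulAut.mul_apply, map_mul,
      MonoidHom.id_apply, mul_assoc]

/-- A transitive subgroup of `Hol(N)` that contains an automorphism `α` of prime order `q`
dividing the order of `N` does not have `⟨α⟩` as a Sylow `q`-subgroup. -/
theorem Hol.IsTransitive.not_isSylowIn_closure_inr {N : Type*} [Group N] [Finite (Hol N)] {q : ℕ}
    (hq : q.Prime) {M : Subgroup (Hol N)} (hM : Hol.IsTransitive M) {f : MulAut N}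
    (hf : orderOf f = q) (hN : q ∣ Nat.card N) :
    ¬ IsSylowIn q M (Subgroup.closure {(SemidirectProduct.inr f : Hol N)}) := by
  intro h
  have hord : orderOf (SemidirectProduct.inr f : Hol N) = q :=
    (orderOf_injective _ SemidirectProduct.inr_injective f).trans hf
  have hfM : SemidirectProduct.inr f ∈ M := h.le (Subgroup.mem_closure_singleton_self _)
  let _ := Hol.mulAction N
  have : MulAction.IsPretransitive M N := ⟨fun x y => by
    obtain ⟨g, hg, hgx⟩ := hM x y
    exact ⟨⟨g, hg⟩, hgx⟩⟩
  have hst : (⟨SemidirectProduct.inr f, hfM⟩ : M) ∈ MulAction.stabilizer M (1 : N) := by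
    rw [MulAction.mem_stabilizer_iff]
    change (1 : N) * f 1 = 1
    rw [map_one, mul_one]
  have h1 : q ∣ Nat.card (MulAction.stabilizer M (1 : N)) := by
    have := Subgroup.orderOf_dvd_natCard _ hst
    rwa [Subgroup.orderOf_mk, hord] at this
  -- By orbit-stabilizer |M| is the order of the stabilizer of 1 times |N|, and `q` divides both
  -- factors.
  have h2 : q ^ 2 ∣ Nat.card M := by
    rw [← Subgroup.card_mul_index (MulAction.stabilizer M (1 : N)),
      MulAction.index_stabilizer_of_transitive, pow_two]
    exact mul_dvd_mul h1 hN
  obtain ⟨P, hP⟩ := h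
  have : Fact q.Prime := ⟨hq⟩
  have h3 := P.pow_dvd_card_of_pow_dvd_card h2
  have h4 : Nat.card (P : Subgroup M) = q := by
    rw [Nat.card_congr ((P : Subgroup M).equivMapOfInjective _ M.subtype_injective).toEquiv, hP,
      ← Subgroup.zpowers_eq_closure, Nat.card_zpowers, hord]
  have h5 := Nat.le_of_dvd hq.pos (h4 ▸ h3)
  have := hq.two_le
  nlinarith

/-! ### The group ⟨α, e₁, e₂⟩ and the Sylow subgroup of `M`. -/

namespace CunninghamData

variable {D : CunninghamData} {j : D.Idx} (hj : D.InCm j) (hi : (j : ℕ) + 1 + 1 ∈ D.I)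

section

variable {u : (ZMod (D.p j))ˣ} (hu : orderOf u = D.p (j + 1)) {α : Hol D.N}
  (hα : α = SemidirectProduct.inr (D.powAut j hj u))

theorem bot_ne_self : j ≠ D.bot hi := fun h => by
  have : (j : ℕ) = j + 1 := congrArg Subtype.val h
  omega

theorem prime_p_succ {j : D.Idx} (hi : (j : ℕ) + 1 + 1 ∈ D.I) : (D.p (j + 1)).Prime := D.prime_p _ (D.bot hi).2

include hα

theorem α_pow_p (hu : orderOf u = D.p (j + 1)) : α ^ D.p (j + 1) = 1 := by
  rw [hα, ← map_pow, powAut_pow, ← hu, pow_orderOf_eq_one, powAut_one, map_one]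

theorem commute_α_e₁ : Commute α (D.e₁ hi) :=
  hα ▸ commute_powAut hj u (σ_coord_of_ne (bot_ne_self hi))

theorem commute_α_e₂ : Commute α (D.e₂ hi) :=
  hα ▸ commute_powAut hj u (σ_coord_of_ne (bot_ne_self hi))

theorem scale_α : D.scale j α = u := by rw [hα, scale_powAut_self]

end

theorem scale_e₁ (a : D.Idx) : D.scale a (D.e₁ hi) = 1 := scale_inl a _

-- The automorphism part of e₂ is inner, so it fixes the central element σ_j.
include hj in
theorem scale_e₂ : D.scale j (D.e₂ hi) = 1 := by
  apply Units.ext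
  rw [scale_coe, e₂_eq]
  have : (MulAut.conj (D.σ (D.bot hi)))⁻¹ (D.σ j) = D.σ j := by
    have hc : D.σ j ∈ Subgroup.center D.N := by
      rw [← Cm_eq_center]
      exact fun a ha => σ_coord_of_ne fun h => ha (h ▸ hj)
    rw [← map_inv, MulAut.conj_apply, Subgroup.mem_center_iff.1 hc, mul_inv_cancel_right]
  exact (congrArg (fun x => N.coord x j) this).trans (σ_coord_self j)

theorem orderOf_powAut (u : (ZMod (D.p j))ˣ) : orderOf (D.powAut j hj u) = orderOf u := by
  have h : ∀ n : ℕ, D.powAut j hj u ^ n = 1 ↔ u ^ n = 1 := by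
    intro n
    rw [powAut_pow]
    refine ⟨fun h => ?_, fun h => by rw [h, powAut_one]⟩
    have := scale_powAut_self j hj (u ^ n)
    rw [h, map_one, map_one] at this
    exact this.symm
  exact orderOf_eq_orderOf_iff.2 h

/-- The elements `α, e₁, e₂` are independent. -/
theorem dvd_of_zpow_mul_zpow_mul_zpow_eq_one {u : (ZMod (D.p j))ˣ}
    (hu : orderOf u = D.p (j + 1)) {α : Hol D.N}
    (hα : α = SemidirectProduct.inr (D.powAut j hj u)) {x m n : ℤ}
    (h : α ^ x * D.e₁ hi ^ m * D.e₂ hi ^ n = 1) :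
    (D.p (j + 1) : ℤ) ∣ x ∧ (D.p (j + 1) : ℤ) ∣ m ∧ (D.p (j + 1) : ℤ) ∣ n := by
  have hx : (D.p (j + 1) : ℤ) ∣ x := by
    have h1 := congrArg (D.scale j) h
    rw [map_mul, map_mul, map_zpow, map_zpow, map_zpow, scale_α hj hα, scale_e₁, scale_e₂ hj hi,
      one_zpow, one_zpow, mul_one, mul_one, map_one] at h1
    rw [← hu]
    exact orderOf_dvd_iff_zpow_eq_one.2 h1
  rw [zpow_eq_one_of_dvd (α_pow_p hj hα hu) hx, one_mul] at h
  have : NeZero (D.p (j + 1)) := ⟨(prime_p_succ hi).ne_zero⟩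
  -- The automorphism part sees e₂ but not e₁: conjugation by σ_{i-1} moves σ_i because k_i ≠ 1.
  have hn : (D.p (j + 1) : ℤ) ∣ n := by
    by_contra hn
    have h1 : D.e₂ hi ^ n ∈ (SemidirectProduct.rightHom (φ := MonoidHom.id (MulAut D.N))).ker := by
      have h1 := congrArg SemidirectProduct.rightHom h
      rwa [map_mul, map_zpow _ (D.e₁ hi), show SemidirectProduct.rightHom (D.e₁ hi) = 1 from rfl,
        one_zpow, one_mul, map_one] at h1
    have h2 : (D.e₂ hi).right = 1 := mem_of_zpow_mem (prime_p_succ hi) (e₂_pow_p hi) hn h1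
    rw [e₂_eq] at h2
    have h3 := congrArg (fun f : MulAut D.N => f (D.σ (D.top hi))) (inv_eq_one.1 h2)
    simp only [MulAut.conj_apply, MulAut.one_apply, mul_inv_eq_iff_eq_mul] at h3
    have h4 := congrArg (fun x => N.coord x (D.bot hi)) h3
    simp only [N.mul_coord, σ_top_twist, σ_bot_twist, σ_coord_self] at h4
    exact kmod_ne_one hi (by linear_combination -h4)
  rw [zpow_eq_one_of_dvd (e₂_pow_p hi) hn, mul_one] at h
  refine ⟨hx, ?_, hn⟩
  by_contra hm
  have h1 : D.e₁ hi = 1 :=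
    mem_of_zpow_mem (M := ⊥) (prime_p_succ hi) (e₁_pow_p hi) hm h
  have h2 := congrArg (fun g : Hol D.N => g.left.coord (D.bot hi)) h1
  simp only [e₁, σ_coord_self, SemidirectProduct.one_left, N.one_coord] at h2
  exact one_ne_zero h2

variable {u : (ZMod (D.p j))ˣ} (hu : orderOf u = D.p (j + 1)) {α : Hol D.N}
  (hα : α = SemidirectProduct.inr (D.powAut j hj u)) {M : Subgroup (Hol D.N)}

include hi hu hα

theorem scale_α_ne_one : D.scale j α ≠ 1 := by
  rw [scale_α hj hα]
  rintro rfl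
  rw [orderOf_one] at hu
  exact (prime_p_succ hi).ne_one hu.symm

theorem inl_σ_mem_of_π (hM : Hol.IsTransitive M) (hαM : D.π α ∈ M.map D.π) :
    SemidirectProduct.inl (D.σ j) ∈ M := by
  obtain ⟨g, hg, hgα⟩ := exists_scale_eq_of_π hj hαM
  exact inl_σ_mem hj hM hg (hgα ▸ scale_α_ne_one hj hi hu hα)

/-- The q-part of an element of `M` scaling like α, conjugated so that it fixes 0 in coordinate `j`,
commutes with α. Its quotient by α is then a q-element without scalings, so it lies in P. -/
theorem exists_α_mul_mem (hM : Hol.IsTransitive M) (hαM : D.π α ∈ M.map D.π) :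
    ∃ m n : ℤ, α * D.e₁ hi ^ m * D.e₂ hi ^ n ∈ M := by
  obtain ⟨g, hg, hgα⟩ := exists_scale_eq_of_π hj hαM
  rw [scale_α hj hα] at hgα
  obtain ⟨e, n, hn, he⟩ := exists_pow_prime_pow_eq_one (prime_p_succ hi) g
  have hσ := inl_σ_mem_of_π hj hi hu hα hM hαM
  have hu1 : (u : ZMod (D.p j)) - 1 ≠ 0 := fun h =>
    scale_α_ne_one hj hi hu hα (by rw [scale_α hj hα]; exact Units.ext (sub_eq_zero.1 h))
  have hge : D.scale j (g ^ e) = u := by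
    rw [map_pow, hgα, pow_eq_pow_of_modEq he (hu ▸ pow_orderOf_eq_one u), pow_one]
  -- Conjugation by translation by t adds (1 - u)t to the left coordinate at `j`; this t makes it
  -- zero.
  set t : ℕ := ((g ^ e).left.coord j * ((u : ZMod (D.p j)) - 1)⁻¹).val with ht
  obtain ⟨s, hs⟩ : ∃ s : Hol D.N, s = SemidirectProduct.inl (D.σ j ^ t) := ⟨_, rfl⟩
  have hsM : s ∈ M := by
    rw [hs, map_pow]
    exact pow_mem hσ t
  have hss : ∀ a, D.scale a s = 1 := fun a => hs ▸ scale_inl a _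
  have hsl : s.left.coord j = t := by
    rw [hs, SemidirectProduct.left_inl, σ_pow_coord_self]
  obtain ⟨y, hy⟩ : ∃ y, y = s * g ^ e * s⁻¹ := ⟨_, rfl⟩
  have hyM : y ∈ M := hy ▸ mul_mem (mul_mem hsM (pow_mem hg e)) (inv_mem hsM)
  have hyn : y ^ D.p (j + 1) ^ n = 1 := by
    rw [hy, conj_pow, hn, mul_one, mul_inv_cancel]
  have hys : D.scale j y = u := by
    rw [hy, map_mul, map_mul, map_inv, hss, hge, one_mul, inv_one, mul_one]
  have hyj : y.left.coord j = 0 := by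
    have h1 : y * s = s * g ^ e := by rw [hy, inv_mul_cancel_right]
    have h2 := left_mul_coord y s hj.2
    rw [h1, left_mul_coord _ _ hj.2, hss, hys, hsl, ht, ZMod.natCast_zmod_val,
      Units.val_one] at h2
    field_simp at h2
    have h3 : y.left.coord j * ((u : ZMod (D.p j)) - 1) = 0 := by linear_combination -h2
    exact (mul_eq_zero.1 h3).resolve_right hu1
  have hc : Commute α y := hα ▸ commute_powAut hj u hyj
  have hpow : (α⁻¹ * y) ^ D.p (j + 1) ^ (n + 1) = 1 := by
    rw [hc.inv_left.mul_pow, inv_pow, pow_succ' (D.p (j + 1)), pow_mul, α_pow_p hj hα hu, one_pow,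
      inv_one, one_mul, mul_comm, pow_mul, hyn, one_pow]
  have hscale : ∀ a, D.scale a (α⁻¹ * y) = 1 := by
    intro a
    by_cases ha : a = j
    · subst ha
      rw [map_mul, map_inv, scale_α hj hα, hys, inv_mul_cancel]
    · exact scale_eq_one_of_pow_eq_one (b := D.bot hi)
        (fun h => ha (Subtype.ext (Nat.succ_injective h))) hpow
  obtain ⟨m, n, hmn⟩ := eq_e₁_pow_mul_e₂_pow hi hscale hpow
  refine ⟨m, n, ?_⟩
  rwa [zpow_natCast, zpow_natCast, mul_assoc, ← hmn, mul_inv_cancel_left]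

theorem pow_p_eq_one_of_mem_closure {g : Hol D.N}
    (hg : g ∈ Subgroup.closure {α, D.e₁ hi, D.e₂ hi}) : g ^ D.p (j + 1) = 1 := by
  obtain ⟨x, m, n, rfl⟩ := exists_zpow_of_mem_closure_triple (commute_α_e₁ hj hi hα)
    (commute_α_e₂ hj hi hα) (commute_e₁_e₂ hi) hg
  have h1 := commute_α_e₁ hj hi hα
  have h2 := commute_α_e₂ hj hi hα
  have h3 := commute_e₁_e₂ hi
  rw [((h2.zpow_zpow x n).mul_left (h3.zpow_zpow m n)).mul_pow, (h1.zpow_zpow x m).mul_pow]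
  simp only [← zpow_natCast, ← zpow_mul]
  rw [zpow_eq_one_of_dvd (α_pow_p hj hα hu) (Dvd.intro_left _ rfl),
    zpow_eq_one_of_dvd (e₁_pow_p hi) (Dvd.intro_left _ rfl),
    zpow_eq_one_of_dvd (e₂_pow_p hi) (Dvd.intro_left _ rfl), one_mul, one_mul]

theorem isPGroup_closure_inf (M : Subgroup (Hol D.N)) :
    IsPGroup (D.p (j + 1)) ↥(Subgroup.closure {α, D.e₁ hi, D.e₂ hi} ⊓ M) :=
  fun g => ⟨1, Subtype.ext (by
    rw [pow_one]
    exact pow_p_eq_one_of_mem_closure hj hi hu hα g.2.1)⟩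

-- The unit group modulo p_j has order 2q with q odd, so a q-element in it has order dividing q, and
-- ⟨u⟩ consists of all q-th roots of unity.
omit hα in
theorem scale_mem_zpowers {g : Hol D.N} {n : ℕ} (hn : g ^ D.p (j + 1) ^ n = 1) :
    D.scale j g ∈ Subgroup.zpowers u := by
  have hq := prime_p_succ hi
  have : NeZero (D.p (j + 1)) := ⟨hq.ne_zero⟩
  have hu' : IsPrimitiveRoot u (D.p (j + 1)) := hu ▸ IsPrimitiveRoot.orderOf u
  rw [hu'.zpowers_eq, mem_rootsOfUnity]
  have h1 : D.scale j g ^ (D.p (j + 1) ^ n) = 1 := by rw [← map_pow, hn, map_one]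
  have h2 : D.scale j g ^ (D.p j - 1) = 1 := ZMod.units_pow_card_sub_one_eq_one _ _
  have hb := Finset.mem_Icc.1 (D.bot hi).2
  have h0 : D.p j - 1 = 2 * D.p (j + 1) := by
    rw [D.chain j (Finset.mem_Icc.1 j.2).1 hb.2, Nat.add_sub_cancel]
  rw [h0] at h2
  have h3 : Nat.Coprime (D.p (j + 1) ^ n) 2 :=
    Nat.Coprime.pow_left _ ((D.odd_p _ (D.bot hi).2).coprime_two_right)
  have h4 : Nat.gcd (D.p (j + 1) ^ n) (2 * D.p (j + 1)) ∣ D.p (j + 1) :=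
    (Nat.Coprime.coprime_dvd_left (Nat.gcd_dvd_left _ _) h3).dvd_of_dvd_mul_left
      (Nat.gcd_dvd_right _ _)
  exact orderOf_dvd_iff_pow_eq_one.1
    ((orderOf_dvd_of_pow_eq_one (pow_gcd_eq_one.2 ⟨h1, h2⟩)).trans h4)

/-- The elements of `M` in `⟨α, e₁, e₂⟩` form a Sylow subgroup of `M`. -/
theorem isSylowIn_closure_inf (hM : Hol.IsTransitive M) (hαM : D.π α ∈ M.map D.π) :
    IsSylowIn (D.p (j + 1)) M (Subgroup.closure {α, D.e₁ hi, D.e₂ hi} ⊓ M) := by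
  refine isSylowIn_of_forall inf_le_right (isPGroup_closure_inf hj hi hu hα M)
    fun R hR hRM hQR y hy => ⟨?_, hRM hy⟩
  have hRpow : ∀ y ∈ R, ∃ n : ℕ, y ^ D.p (j + 1) ^ n = 1 := fun y hy =>
    (hR ⟨y, hy⟩).imp fun n hn => congrArg Subtype.val hn
  obtain ⟨m, n, hmn⟩ := exists_α_mul_mem hj hi hu hα hM hαM
  set v := α * D.e₁ hi ^ m * D.e₂ hi ^ n with hv
  have hvQ : v ∈ Subgroup.closure {α, D.e₁ hi, D.e₂ hi} := by
    have := mem_closure_triple (a := α) (e := D.e₁ hi) (f := D.e₂ hi) 1 m n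
    rwa [zpow_one] at this
  have hvs : D.scale j v = u := by
    rw [hv, map_mul, map_mul, map_zpow, map_zpow, scale_e₁, scale_e₂ hj hi, scale_α hj hα,
      one_zpow, one_zpow, mul_one, mul_one]
  obtain ⟨l, hl⟩ := hRpow y hy
  obtain ⟨x, hx⟩ := Subgroup.mem_zpowers_iff.1 (scale_mem_zpowers hi hu hl)
  -- Dividing by the power of `v` with the same scaling at `j` leaves an element of `R`, hence a
  -- q-element, and all its scalings are trivial.
  have hzR : (v ^ x)⁻¹ * y ∈ R := mul_mem (inv_mem (zpow_mem (hQR ⟨hvQ, hmn⟩) x)) hy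
  obtain ⟨k, hk⟩ := hRpow _ hzR
  have hscale : ∀ a, D.scale a ((v ^ x)⁻¹ * y) = 1 := by
    intro a
    by_cases ha : a = j
    · subst ha
      rw [map_mul, map_inv, map_zpow, hvs, hx, inv_mul_cancel]
    · exact scale_eq_one_of_pow_eq_one (b := D.bot hi)
        (fun h => ha (Subtype.ext (Nat.succ_injective h))) hk
  obtain ⟨m', n', h⟩ := eq_e₁_pow_mul_e₂_pow hi hscale hk
  rw [inv_mul_eq_iff_eq_mul.1 h]
  refine mul_mem (zpow_mem hvQ x) ?_
  have := mem_closure_triple (a := α) (e := D.e₁ hi) (f := D.e₂ hi) 0 m' n'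
  rwa [zpow_zero, one_mul, zpow_natCast, zpow_natCast] at this

end CunninghamData

/-! ### Constraints imposed by the diagonal action ω. -/

namespace CunninghamData

variable {D : CunninghamData}

section

variable {j : ℕ} (h : j + 1 ∈ D.I)

theorem ω_coe_zero (g : Hol D.N) :
    (D.ω h g : Matrix (Fin 2) (Fin 2) (ZMod (D.p (D.bot h)))) 0 0 =
      g.left.twist (D.bot h) * botExp g.right h := rfl

theorem ω_coe_one (g : Hol D.N) :
    (D.ω h g : Matrix (Fin 2) (Fin 2) (ZMod (D.p (D.bot h)))) 1 1 = botExp g.right h := rfl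

theorem conj_e₁_zpow (g : Hol D.N) (m : ℤ) :
    g * D.e₁ h ^ m * g⁻¹ =
      D.e₁ h ^ ((((D.ω h g : Matrix (Fin 2) (Fin 2) (ZMod (D.p (D.bot h)))) 0 0).val : ℤ) * m) := by
  rw [← conj_zpow, conj_e₁, ← zpow_natCast, ← zpow_mul]

theorem conj_e₂_zpow (g : Hol D.N) (m : ℤ) :
    g * D.e₂ h ^ m * g⁻¹ =
      D.e₂ h ^ ((((D.ω h g : Matrix (Fin 2) (Fin 2) (ZMod (D.p (D.bot h)))) 1 1).val : ℤ) * m) := by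
  rw [← conj_zpow, conj_e₂, ← zpow_natCast, ← zpow_mul]

theorem exists_left_eq {M : Subgroup (Hol D.N)} (hM : Hol.IsTransitive M) (x : D.N) :
    ∃ g ∈ M, g.left = x := by
  obtain ⟨g, hg, h⟩ := hM 1 x
  exact ⟨g, hg, by rwa [map_one, mul_one] at h⟩

/-- For transitive `M`, the intersection of `M` with `P (i - 1)` is spanned by its intersections
with `⟨e₁⟩` and `⟨e₂⟩`. -/
theorem e₁_zpow_mem_and_e₂_zpow_mem {M : Subgroup (Hol D.N)} (hM : Hol.IsTransitive M) {m n : ℤ}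
    (hmn : D.e₁ h ^ m * D.e₂ h ^ n ∈ M) : D.e₁ h ^ m ∈ M ∧ D.e₂ h ^ n ∈ M := by
  -- The left part σ_i makes the two eigenvalues of ω(g) differ by the factor k_i ≠ 1.
  obtain ⟨g, hg, hgl⟩ := exists_left_eq hM (D.σ (D.top h))
  set X := ((D.ω h g : Matrix (Fin 2) (Fin 2) (ZMod (D.p (D.bot h)))) 0 0) with hX
  set Y := ((D.ω h g : Matrix (Fin 2) (Fin 2) (ZMod (D.p (D.bot h)))) 1 1) with hY
  have h1 : D.e₁ h ^ ((X.val : ℤ) * m) * D.e₂ h ^ ((Y.val : ℤ) * n) ∈ M := by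
    rw [hX, hY, ← conj_e₁_zpow, ← conj_e₂_zpow]
    have := mul_mem (mul_mem hg hmn) (inv_mem hg)
    convert this using 1
    group
  -- Subtracting `Y` times the original vector from its conjugate removes the e₂-component.
  have h2 : (D.e₁ h ^ m) ^ ((X.val : ℤ) - Y.val) ∈ M := by
    have := mul_mem h1 (inv_mem (zpow_mem hmn (Y.val : ℤ)))
    rw [((commute_e₁_e₂ h).zpow_zpow m n).mul_zpow, ← zpow_mul, ← zpow_mul, mul_inv_rev,
      mul_comm n, mul_assoc, mul_inv_cancel_left, ← zpow_neg, ← zpow_add] at this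
    rw [← zpow_mul]
    convert this using 2
    ring
  have h3 : ¬ (D.p j : ℤ) ∣ (X.val : ℤ) - Y.val := by
    rw [show D.p j = D.p (D.bot h) from rfl, ← ZMod.intCast_zmod_eq_zero_iff_dvd]
    push_cast
    rw [ZMod.natCast_zmod_val, ZMod.natCast_zmod_val, hX, hY, ω_coe_zero, ω_coe_one, hgl,
      σ_top_twist]
    intro h0
    have h4 : (D.kmod h - 1) * botExp g.right h = 0 := by linear_combination h0
    rcases mul_eq_zero.1 h4 with h5 | h5
    · exact kmod_ne_one h (sub_eq_zero.1 h5)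
    · exact botExp_ne_zero _ _ h5
  have h4 : D.e₁ h ^ m ∈ M := by
    refine mem_of_zpow_mem (D.prime_p j (D.bot h).2) ?_ h3 h2
    rw [← zpow_natCast, zpow_comm, zpow_natCast, e₁_pow_p, one_zpow]
  exact ⟨h4, (Subgroup.mul_mem_cancel_left _ h4).1 hmn⟩

theorem coe_pow_of_coe_eq_diag {K : Type*} [Field K] {U : GL (Fin 2) K} {a b : K}
    (hU : (U : Matrix (Fin 2) (Fin 2) K) = !![a, 0; 0, b]) (n : ℕ) :
    ((U ^ n : GL (Fin 2) K) : Matrix (Fin 2) (Fin 2) K) = !![a ^ n, 0; 0, b ^ n] := by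
  induction n with
  | zero => simp [Matrix.one_fin_two]
  | succ n ih =>
    rw [pow_succ, Units.val_mul, ih, hU, Matrix.mul_fin_two]
    simp [pow_succ]

theorem S_mul_A_inv_coe :
    ((D.S h * (D.A h)⁻¹ : GL (Fin 2) (ZMod (D.p (D.bot h)))) :
      Matrix (Fin 2) (Fin 2) (ZMod (D.p (D.bot h)))) = !![1, 0; 0, (D.kmod h)⁻¹] := by
  have hk := kmod_ne_zero h
  have : D.S h * (D.A h)⁻¹ = Matrix.GeneralLinearGroup.mkOfDetNeZero !![1, 0; 0, (D.kmod h)⁻¹]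
      (by simpa using hk) := by
    rw [mul_inv_eq_iff_eq_mul]
    apply Units.ext
    rw [Units.val_mul]
    change !![D.kmod h, 0; 0, 1] = !![1, 0; 0, (D.kmod h)⁻¹] * !![D.kmod h, 0; 0, D.kmod h]
    simp [hk]
  rw [this]
  rfl

/-- With second entry 1, the first entry is the twist, a power of k_i with exponent the i-th
coordinate of the left part; by transitivity the exponent 1 occurs. -/
theorem map_ω_eq_zpowers_S {M : Subgroup (Hol D.N)} (hM : Hol.IsTransitive M)
    (h1 : ∀ g ∈ M, botExp g.right h = 1) : M.map (D.ω h) = Subgroup.zpowers (D.S h) := by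
  have hS : ((D.S h : GL (Fin 2) (ZMod (D.p (D.bot h)))) :
      Matrix (Fin 2) (Fin 2) (ZMod (D.p (D.bot h)))) = !![D.kmod h, 0; 0, 1] := rfl
  have key : ∀ g ∈ M, D.ω h g = D.S h ^ (g.left.coord (D.top h)).val := by
    intro g hg
    apply Units.ext
    rw [coe_pow_of_coe_eq_diag hS, ω_coe, h1 g hg, N.twist_bot, mul_one, one_pow]
  apply le_antisymm
  · rintro _ ⟨g, hg, rfl⟩
    rw [key g hg]
    exact Subgroup.npow_mem_zpowers _ _
  · rw [Subgroup.zpowers_le]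
    obtain ⟨g, hg, hgl⟩ := exists_left_eq hM (D.σ (D.top h))
    refine ⟨g, hg, ?_⟩
    rw [key g hg, hgl, σ_coord_self, ZMod.val_one, pow_one]

/-- Here the second entry is the inverse of the twist, and the exponent 1 occurs again by
transitivity. -/
theorem map_ω_eq_zpowers_S_mul_A_inv {M : Subgroup (Hol D.N)} (hM : Hol.IsTransitive M)
    (h1 : ∀ g ∈ M, g.left.twist (D.bot h) * botExp g.right h = 1) :
    M.map (D.ω h) = Subgroup.zpowers (D.S h * (D.A h)⁻¹) := by
  have key : ∀ g ∈ M, D.ω h g = (D.S h * (D.A h)⁻¹) ^ (g.left.coord (D.top h)).val := by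
    intro g hg
    apply Units.ext
    rw [coe_pow_of_coe_eq_diag (S_mul_A_inv_coe h), ω_coe, h1 g hg, inv_pow, ← N.twist_bot,
      one_pow, eq_inv_of_mul_eq_one_right (h1 g hg)]
  apply le_antisymm
  · rintro _ ⟨g, hg, rfl⟩
    rw [key g hg]
    exact Subgroup.npow_mem_zpowers _ _
  · rw [Subgroup.zpowers_le]
    obtain ⟨g, hg, hgl⟩ := exists_left_eq hM (D.σ (D.top h))
    refine ⟨g, hg, ?_⟩
    rw [key g hg, hgl, σ_coord_self, ZMod.val_one, pow_one]

end

variable {j : D.Idx} (hj : D.InCm j) (hi : (j : ℕ) + 1 + 1 ∈ D.I)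

include hj in
theorem ω_inl_σ_pow (t : ℕ) : D.ω hi (SemidirectProduct.inl (D.σ j ^ t)) = 1 := by
  apply Units.ext
  rw [ω_coe, SemidirectProduct.left_inl, SemidirectProduct.right_inl, botExp_one,
    σ_pow_twist_of_notMem hj.1, mul_one, Units.val_one, Matrix.one_fin_two]

variable {u : (ZMod (D.p j))ˣ} (hu : orderOf u = D.p (j + 1)) {α : Hol D.N}
  (hα : α = SemidirectProduct.inr (D.powAut j hj u)) {M : Subgroup (Hol D.N)}

include hi hu hα

/-- The class of `v ∈ P (i - 1)` with `α v ∈ M` is fixed by `ω(M)` modulo `M ∩ P (i - 1)`. -/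
theorem zpow_sub_one_mem (hM : Hol.IsTransitive M) (hαM : D.π α ∈ M.map D.π) {m n : ℤ}
    (hmn : α * D.e₁ hi ^ m * D.e₂ hi ^ n ∈ M) {g : Hol D.N} (hg : g ∈ M) :
    D.e₁ hi ^ (((((D.ω hi g : Matrix (Fin 2) (Fin 2) (ZMod (D.p (D.bot hi)))) 0 0).val : ℤ) - 1)
        * m) ∈ M ∧
      D.e₂ hi ^ (((((D.ω hi g : Matrix (Fin 2) (Fin 2) (ZMod (D.p (D.bot hi)))) 1 1).val : ℤ) - 1)
        * n) ∈ M := by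
  -- A translation by σ_j, which lies in `M` and in the kernel of ω, turns `g` into an element
  -- fixing 0 in coordinate `j`, hence commuting with α.
  obtain ⟨s, hs⟩ : ∃ s : Hol D.N,
    s = SemidirectProduct.inl (D.σ j ^ (-g.left.coord j).val) := ⟨_, rfl⟩
  have hsM : s ∈ M := by
    rw [hs, map_pow]
    exact pow_mem (inl_σ_mem_of_π hj hi hu hα hM hαM) _
  have hω : D.ω hi (s * g) = D.ω hi g := by rw [map_mul, hs, ω_inl_σ_pow hj, one_mul]
  have hyM : s * g ∈ M := mul_mem hsM hg
  have hyj : (s * g).left.coord j = 0 := by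
    rw [left_mul_coord _ _ hj.2, hs, scale_inl, SemidirectProduct.left_inl, σ_pow_coord_self,
      ZMod.natCast_zmod_val, Units.val_one]
    ring
  rw [← hω]
  generalize s * g = y at hyM hyj
  have hc : Commute α y := hα ▸ commute_powAut hj u hyj
  have h1 := conj_e₁_zpow hi y m
  have h2 := conj_e₂_zpow hi y n
  set X := ((D.ω hi y : Matrix (Fin 2) (Fin 2) (ZMod (D.p (D.bot hi)))) 0 0)
  set Y := ((D.ω hi y : Matrix (Fin 2) (Fin 2) (ZMod (D.p (D.bot hi)))) 1 1)
  apply e₁_zpow_mem_and_e₂_zpow_mem hi hM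
  -- Since `y` commutes with α, this commutator of αv and `y` is ω(y)v - v in additive notation.
  have h3 := mul_mem (inv_mem hmn) (mul_mem (mul_mem hyM hmn) (inv_mem hyM))
  have h4 : y * (α * D.e₁ hi ^ m * D.e₂ hi ^ n) * y⁻¹ =
      α * D.e₁ hi ^ ((X.val : ℤ) * m) * D.e₂ hi ^ ((Y.val : ℤ) * n) := by
    rw [← h1, ← h2]
    have : y * α = α * y := hc.eq.symm
    simp only [← mul_assoc]
    rw [this]
    group
  have h5 := zpow_mul_zpow_mul_zpow (commute_α_e₁ hj hi hα) (commute_α_e₂ hj hi hα)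
    (commute_e₁_e₂ hi) m n 1 ((X.val : ℤ) * m) ((Y.val : ℤ) * n)
  rw [zpow_one, zpow_one] at h5
  rw [h4, h5, inv_mul_cancel_left] at h3
  convert h3 using 3 <;> ring

/-- If the second entry of ω(g) were not 1, then (ω(g) - 1)v would have a nonzero e₂-component in
`M`, forcing e₂ ∈ M. -/
theorem ω_one_eq_one (hM : Hol.IsTransitive M) (hαM : D.π α ∈ M.map D.π) {m n : ℤ}
    (hmn : α * D.e₁ hi ^ m * D.e₂ hi ^ n ∈ M) (he : D.e₂ hi ∉ M) (hn : ¬ (D.p (j + 1) : ℤ) ∣ n)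
    {g : Hol D.N} (hg : g ∈ M) : botExp g.right hi = 1 := by
  have h1 := (zpow_sub_one_mem hj hi hu hα hM hαM hmn hg).2
  have h2 := not_imp_comm.1 (fun h => mem_of_zpow_mem (prime_p_succ hi) (e₂_pow_p hi) h h1) he
  have h3 := ((Nat.prime_iff_prime_int.1 (prime_p_succ hi)).dvd_or_dvd h2).resolve_right hn
  rw [show D.p (j + 1) = D.p (D.bot hi) from rfl, ← ZMod.intCast_zmod_eq_zero_iff_dvd] at h3
  push_cast at h3
  rw [ZMod.natCast_zmod_val, ω_coe_one] at h3
  exact sub_eq_zero.1 h3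

theorem ω_zero_eq_one (hM : Hol.IsTransitive M) (hαM : D.π α ∈ M.map D.π) {m n : ℤ}
    (hmn : α * D.e₁ hi ^ m * D.e₂ hi ^ n ∈ M) (he : D.e₁ hi ∉ M) (hm : ¬ (D.p (j + 1) : ℤ) ∣ m)
    {g : Hol D.N} (hg : g ∈ M) : g.left.twist (D.bot hi) * botExp g.right hi = 1 := by
  have h1 := (zpow_sub_one_mem hj hi hu hα hM hαM hmn hg).1
  have h2 := not_imp_comm.1 (fun h => mem_of_zpow_mem (prime_p_succ hi) (e₁_pow_p hi) h h1) he
  have h3 := ((Nat.prime_iff_prime_int.1 (prime_p_succ hi)).dvd_or_dvd h2).resolve_right hm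
  rw [show D.p (j + 1) = D.p (D.bot hi) from rfl, ← ZMod.intCast_zmod_eq_zero_iff_dvd] at h3
  push_cast at h3
  rw [ZMod.natCast_zmod_val, ω_coe_zero] at h3
  exact sub_eq_zero.1 h3

/-- In the absence of `e₁` and `e₂`, an element `α v` of `M` has `v` in `⟨e₁⟩` or in `⟨e₂⟩`. -/
theorem dvd_or_dvd_of_notMem (hM : Hol.IsTransitive M) (hαM : D.π α ∈ M.map D.π) {m n : ℤ}
    (hmn : α * D.e₁ hi ^ m * D.e₂ hi ^ n ∈ M) (he₁ : D.e₁ hi ∉ M) (he₂ : D.e₂ hi ∉ M) :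
    (D.p (j + 1) : ℤ) ∣ m ∨ (D.p (j + 1) : ℤ) ∣ n := by
  by_contra! hd
  -- If both components were nonzero, both entries of ω(g) would be 1, although their ratio is k_i.
  obtain ⟨g, hg, hgl⟩ := exists_left_eq hM (D.σ (D.top hi))
  have h1 := ω_one_eq_one hj hi hu hα hM hαM hmn he₂ hd.2 hg
  have h2 := ω_zero_eq_one hj hi hu hα hM hαM hmn he₁ hd.1 hg
  rw [h1, mul_one, hgl, σ_top_twist] at h2
  exact kmod_ne_one hi h2

theorem not_isSylowIn_closure_α (hM : Hol.IsTransitive M) :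
    ¬ IsSylowIn (D.p (j + 1)) M (Subgroup.closure {α}) := by
  rw [hα]
  refine hM.not_isSylowIn_closure_inr (prime_p_succ hi) ((orderOf_powAut hj u).trans hu) ?_
  have h1 : orderOf (D.σ (D.bot hi)) = D.p (j + 1) := by
    have : Fact (D.p (j + 1)).Prime := ⟨prime_p_succ hi⟩
    refine orderOf_eq_prime (σ_pow_eq_one (D.bot hi)) fun h => ?_
    have h2 := congrArg (fun x => N.coord x (D.bot hi)) h
    simp only [σ_coord_self, N.one_coord] at h2
    exact one_ne_zero h2
  rw [← h1]
  exact orderOf_dvd_natCard _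

/-- If e₂ were in `M`, maximality of the Sylow subgroup would put e₂ into ⟨e₁, α e₂^c⟩, against the
independence of α, e₁, e₂. -/
theorem e₂_notMem_of_isSylowIn {c : ℤ}
    (h : IsSylowIn (D.p (j + 1)) M (Subgroup.closure {D.e₁ hi, α * D.e₂ hi ^ c}) ∨
      IsSylowIn (D.p (j + 1)) M (Subgroup.closure {α * D.e₂ hi ^ c})) :
    α * D.e₂ hi ^ c ∈ M ∧ D.e₂ hi ∉ M := by
  have hle : Subgroup.closure {α * D.e₂ hi ^ c} ≤ Subgroup.closure {D.e₁ hi, α * D.e₂ hi ^ c} :=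
    Subgroup.closure_mono (by simp)
  obtain ⟨Q, hQ, hQle, hmem⟩ : ∃ Q, IsSylowIn (D.p (j + 1)) M Q ∧
      Q ≤ Subgroup.closure {D.e₁ hi, α * D.e₂ hi ^ c} ∧ α * D.e₂ hi ^ c ∈ Q := by
    rcases h with h | h
    · exact ⟨_, h, le_rfl, Subgroup.subset_closure (by simp)⟩
    · exact ⟨_, h, hle, Subgroup.mem_closure_singleton_self _⟩
  refine ⟨hQ.le hmem, fun he => ?_⟩
  have hae := commute_α_e₁ hj hi hα
  have haf := commute_α_e₂ hj hi hα
  have hef := commute_e₁_e₂ hi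
  have hle' : Subgroup.closure {D.e₁ hi, α * D.e₂ hi ^ c} ≤
      Subgroup.closure {α, D.e₁ hi, D.e₂ hi} := by
    rw [Subgroup.closure_le]
    rintro x (rfl | rfl)
    · exact Subgroup.subset_closure (by simp)
    · exact mul_mem (Subgroup.subset_closure (by simp))
        (zpow_mem (Subgroup.subset_closure (by simp)) _)
  have h1 := hQ.eq_of_le (isPGroup_closure_inf hj hi hu hα M) inf_le_right
    (le_inf (hQle.trans hle') hQ.le)
  have h2 : D.e₂ hi ∈ Q := h1 ▸ ⟨Subgroup.subset_closure (by simp), he⟩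
  obtain ⟨m, x, hx⟩ := exists_zpow_of_mem_closure_pair
    (hae.symm.mul_right (hef.zpow_right c)) (hQle h2)
  -- From e₂ = e₁^m (α e₂^c)^x one gets α^x e₁^m e₂^(cx-1) = 1, so q divides both x and cx - 1.
  have h3 := zpow_mul_zpow_mul_zpow hae haf hef 0 c x m (c * x - 1)
  rw [zpow_zero, mul_one, show c * x - 1 - c * x = -1 by ring, zpow_neg_one, zero_mul, sub_zero,
    ← mul_assoc, ((hae.symm.mul_right (hef.zpow_right c)).zpow_zpow m x).eq.symm, ← hx,
    mul_inv_cancel] at h3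
  obtain ⟨hx', -, hn⟩ := dvd_of_zpow_mul_zpow_mul_zpow_eq_one hj hi hu hα h3
  exact (Nat.prime_iff_prime_int.1 (prime_p_succ hi)).not_dvd_one
    ((dvd_sub_right (hx'.mul_left c)).1 hn)

theorem e₁_notMem_of_isSylowIn {c : ℤ}
    (h : IsSylowIn (D.p (j + 1)) M (Subgroup.closure {α * D.e₁ hi ^ c, D.e₂ hi}) ∨
      IsSylowIn (D.p (j + 1)) M (Subgroup.closure {α * D.e₁ hi ^ c})) :
    α * D.e₁ hi ^ c ∈ M ∧ D.e₁ hi ∉ M := by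
  have hle : Subgroup.closure {α * D.e₁ hi ^ c} ≤ Subgroup.closure {α * D.e₁ hi ^ c, D.e₂ hi} :=
    Subgroup.closure_mono (by simp)
  obtain ⟨Q, hQ, hQle, hmem⟩ : ∃ Q, IsSylowIn (D.p (j + 1)) M Q ∧
      Q ≤ Subgroup.closure {α * D.e₁ hi ^ c, D.e₂ hi} ∧ α * D.e₁ hi ^ c ∈ Q := by
    rcases h with h | h
    · exact ⟨_, h, le_rfl, Subgroup.subset_closure (by simp)⟩
    · exact ⟨_, h, hle, Subgroup.mem_closure_singleton_self _⟩
  refine ⟨hQ.le hmem, fun he => ?_⟩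
  have hae := commute_α_e₁ hj hi hα
  have haf := commute_α_e₂ hj hi hα
  have hef := commute_e₁_e₂ hi
  have hle' : Subgroup.closure {α * D.e₁ hi ^ c, D.e₂ hi} ≤
      Subgroup.closure {α, D.e₁ hi, D.e₂ hi} := by
    rw [Subgroup.closure_le]
    rintro x (rfl | rfl)
    · exact mul_mem (Subgroup.subset_closure (by simp))
        (zpow_mem (Subgroup.subset_closure (by simp)) _)
    · exact Subgroup.subset_closure (by simp)
  have h1 := hQ.eq_of_le (isPGroup_closure_inf hj hi hu hα M) inf_le_right
    (le_inf (hQle.trans hle') hQ.le)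
  have h2 : D.e₁ hi ∈ Q := h1 ▸ ⟨Subgroup.subset_closure (by simp), he⟩
  obtain ⟨x, m, hx⟩ := exists_zpow_of_mem_closure_pair
    (haf.mul_left (hef.zpow_left c)) (hQle h2)
  have h3 : α ^ x * D.e₁ hi ^ (c * x - 1) * D.e₂ hi ^ m = 1 := by
    rw [(hae.zpow_right c).mul_zpow, ← zpow_mul] at hx
    rw [zpow_sub_one, ← mul_assoc, mul_assoc _ (D.e₁ hi)⁻¹, (hef.inv_left.zpow_right m).eq,
      ← mul_assoc, ← hx, mul_inv_cancel]
  obtain ⟨hx', hn, -⟩ := dvd_of_zpow_mul_zpow_mul_zpow_eq_one hj hi hu hα h3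
  exact (Nat.prime_iff_prime_int.1 (prime_p_succ hi)).not_dvd_one
    ((dvd_sub_right (hx'.mul_left c)).1 hn)

end CunninghamData

/-! ### The classification, according to which of e₁, e₂ lie in `M`. -/

theorem exists_pow_eq_zpow {G : Type*} [Group G] {q : ℕ} (hq : 0 < q) {e : G} (he : e ^ q = 1)
    {n : ℤ} (hn : ¬ (q : ℤ) ∣ n) : ∃ c ∈ Finset.Icc 1 (q - 1), e ^ n = e ^ c := by
  have hq' : (0 : ℤ) < q := by exact_mod_cast hq
  have h0 := Int.emod_nonneg n hq'.ne'
  have h1 := Int.emod_lt_of_pos n hq'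
  have h2 : n % q ≠ 0 := fun h => hn (Int.dvd_of_emod_eq_zero h)
  refine ⟨(n % q).toNat, Finset.mem_Icc.2 ⟨by omega, by omega⟩, ?_⟩
  rw [← zpow_natCast, Int.toNat_of_nonneg h0]
  conv_lhs => rw [← Int.emod_add_mul_ediv n q, zpow_add,
    zpow_eq_one_of_dvd he (Dvd.intro _ rfl), mul_one]

namespace CunninghamData

variable {D : CunninghamData} {j : D.Idx} (hj : D.InCm j) (hi : (j : ℕ) + 1 + 1 ∈ D.I)
  {u : (ZMod (D.p j))ˣ} (hu : orderOf u = D.p (j + 1)) {α : Hol D.N}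
  (hα : α = SemidirectProduct.inr (D.powAut j hj u)) {M : Subgroup (Hol D.N)}
include hi hu hα

theorem exists_isSylowIn (hM : Hol.IsTransitive M) (hαM : D.π α ∈ M.map D.π) :
    ∃ Q : Subgroup (Hol D.N), IsSylowIn (D.p (j + 1)) M Q ∧
      (Q = Subgroup.closure {α, D.e₁ hi, D.e₂ hi} ∨
        Q = Subgroup.closure {α, D.e₁ hi} ∨
        Q = Subgroup.closure {α, D.e₂ hi} ∨
        ∃ c ∈ Finset.Icc 1 (D.p (j + 1) - 1),
          Q = Subgroup.closure {D.e₁ hi, α * D.e₂ hi ^ c} ∨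
          Q = Subgroup.closure {α * D.e₂ hi ^ c} ∨
          Q = Subgroup.closure {α * D.e₁ hi ^ c, D.e₂ hi} ∨
          Q = Subgroup.closure {α * D.e₁ hi ^ c}) := by
  have hq := prime_p_succ hi
  have hae := commute_α_e₁ hj hi hα
  have haf := commute_α_e₂ hj hi hα
  have hef := commute_e₁_e₂ hi
  have he₁ := e₁_pow_p hi
  have he₂ := e₂_pow_p hi
  have hS := isSylowIn_closure_inf hj hi hu hα hM hαM
  obtain ⟨m, n, hmn⟩ := exists_α_mul_mem hj hi hu hα hM hαM
  refine ⟨_, hS, ?_⟩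
  by_cases h₁ : D.e₁ hi ∈ M <;> by_cases h₂ : D.e₂ hi ∈ M
  · left
    rw [inf_eq_left, Subgroup.closure_le]
    rintro x (rfl | rfl | rfl)
    · rwa [Subgroup.mul_mem_cancel_right _ (zpow_mem h₂ n),
        Subgroup.mul_mem_cancel_right _ (zpow_mem h₁ m)] at hmn
    · exact h₁
    · exact h₂
  · have h : α * D.e₂ hi ^ n ∈ M := by
      rwa [mul_assoc, (hef.zpow_zpow m n).eq, ← mul_assoc,
        Subgroup.mul_mem_cancel_right _ (zpow_mem h₁ m)] at hmn
    rw [closure_triple_inf_of_mem_of_notMem hq hae haf hef he₂ h₁ h₂ h]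
    by_cases hn : (D.p (j + 1) : ℤ) ∣ n
    · right; left
      rw [zpow_eq_one_of_dvd he₂ hn, mul_one, Set.pair_comm]
    · obtain ⟨c, hc, hnc⟩ := exists_pow_eq_zpow hq.pos he₂ hn
      exact Or.inr (Or.inr (Or.inr ⟨c, hc, Or.inl (by rw [hnc])⟩))
  · have h : α * D.e₁ hi ^ m ∈ M := by
      rwa [Subgroup.mul_mem_cancel_right _ (zpow_mem h₂ n)] at hmn
    -- The previous case with e₁ and e₂ interchanged.
    rw [Set.pair_comm (D.e₁ hi),
      closure_triple_inf_of_mem_of_notMem hq haf hae hef.symm he₁ h₂ h₁ h]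
    by_cases hm : (D.p (j + 1) : ℤ) ∣ m
    · right; right; left
      rw [zpow_eq_one_of_dvd he₁ hm, mul_one, Set.pair_comm]
    · obtain ⟨c, hc, hmc⟩ := exists_pow_eq_zpow hq.pos he₁ hm
      exact Or.inr (Or.inr (Or.inr ⟨c, hc, Or.inr (Or.inr (Or.inl
        (by rw [hmc, Set.pair_comm])))⟩))
  · rw [closure_triple_inf_of_notMem hq hae haf hef he₁ he₂ h₁ h₂
      (fun _ _ => e₁_zpow_mem_and_e₂_zpow_mem hi hM) hmn] at hS ⊢
    by_cases hm : (D.p (j + 1) : ℤ) ∣ m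
    · rw [zpow_eq_one_of_dvd he₁ hm, mul_one] at hS ⊢
      by_cases hn : (D.p (j + 1) : ℤ) ∣ n
      -- Both components vanish, so the Sylow subgroup would be ⟨α⟩.
      · rw [zpow_eq_one_of_dvd he₂ hn, mul_one] at hS
        exact absurd hS (not_isSylowIn_closure_α hj hi hu hα hM)
      · obtain ⟨c, hc, hnc⟩ := exists_pow_eq_zpow hq.pos he₂ hn
        exact Or.inr (Or.inr (Or.inr ⟨c, hc, Or.inr (Or.inl (by rw [hnc]))⟩))
    · have hn := (dvd_or_dvd_of_notMem hj hi hu hα hM hαM hmn h₁ h₂).resolve_left hm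
      rw [zpow_eq_one_of_dvd he₂ hn, mul_one]
      obtain ⟨c, hc, hmc⟩ := exists_pow_eq_zpow hq.pos he₁ hm
      exact Or.inr (Or.inr (Or.inr ⟨c, hc, Or.inr (Or.inr (Or.inr (by rw [hmc])))⟩))

end CunninghamData

theorem mainTheorem10 (D : CunninghamData)
    -- `j` stands for `i - 2`, where `i = j + 2 ∈ I`
    (j : D.Idx) (hj : (j : ℕ) ∉ D.I) (hi : (j : ℕ) + 1 + 1 ∈ D.I)
    -- `α` is the automorphism `α_{i-2}` of `⟨σ_{i-2}⟩` of order `p_{i-1}`, extended to `N`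
    (u : (ZMod (D.p j))ˣ) (hu : orderOf u = D.p (j + 1))
    (α : Hol D.N)
    (hα : α = SemidirectProduct.inr (D.powAut j ⟨hj, fun h => D.I_sparse _ h hi⟩ u))
    (M : Subgroup (Hol D.N)) (hM : Hol.IsTransitive M)
    (hαM : D.π α ∈ M.map D.π) :
    (∃ Q : Subgroup (Hol D.N), IsSylowIn (D.p (j + 1)) M Q ∧
      (Q = Subgroup.closure {α, D.e₁ hi, D.e₂ hi} ∨
        Q = Subgroup.closure {α, D.e₁ hi} ∨
        Q = Subgroup.closure {α, D.e₂ hi} ∨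
        ∃ c ∈ Finset.Icc 1 (D.p (j + 1) - 1),
          Q = Subgroup.closure {D.e₁ hi, α * D.e₂ hi ^ c} ∨
          Q = Subgroup.closure {α * D.e₂ hi ^ c} ∨
          Q = Subgroup.closure {α * D.e₁ hi ^ c, D.e₂ hi} ∨
          Q = Subgroup.closure {α * D.e₁ hi ^ c})) ∧
    (∀ c ∈ Finset.Icc 1 (D.p (j + 1) - 1),
      (IsSylowIn (D.p (j + 1)) M (Subgroup.closure {D.e₁ hi, α * D.e₂ hi ^ c}) ∨
        IsSylowIn (D.p (j + 1)) M (Subgroup.closure {α * D.e₂ hi ^ c}) →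
          M.map (D.ω hi) = Subgroup.zpowers (D.S hi)) ∧
      (IsSylowIn (D.p (j + 1)) M (Subgroup.closure {α * D.e₁ hi ^ c, D.e₂ hi}) ∨
        IsSylowIn (D.p (j + 1)) M (Subgroup.closure {α * D.e₁ hi ^ c}) →
          M.map (D.ω hi) = Subgroup.zpowers (D.S hi * (D.A hi)⁻¹))) := by
  have hjm : D.InCm j := ⟨hj, fun h => D.I_sparse _ h hi⟩
  refine ⟨CunninghamData.exists_isSylowIn hjm hi hu hα hM hαM, fun c hc => ?_⟩
  have hcq : ¬ (D.p (j + 1) : ℤ) ∣ c := by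
    have hc' := Finset.mem_Icc.1 hc
    have := (CunninghamData.prime_p_succ hi).pos
    rw [Int.natCast_dvd_natCast]
    exact Nat.not_dvd_of_pos_of_lt hc'.1 (by omega)
  constructor
  · intro h
    -- The lemmas on αv take integer exponents; here v is c e₂, and c e₁ in the second half.
    simp only [← zpow_natCast] at h
    obtain ⟨h1, h2⟩ := CunninghamData.e₂_notMem_of_isSylowIn hjm hi hu hα h
    refine CunninghamData.map_ω_eq_zpowers_S hi hM fun g hg =>
      CunninghamData.ω_one_eq_one hjm hi hu hα hM hαM (m := 0) (n := c) ?_ h2 hcq hg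
    rwa [zpow_zero, mul_one]
  · intro h
    simp only [← zpow_natCast] at h
    obtain ⟨h1, h2⟩ := CunninghamData.e₁_notMem_of_isSylowIn hjm hi hu hα h
    refine CunninghamData.map_ω_eq_zpowers_S_mul_A_inv hi hM fun g hg =>
      CunninghamData.ω_zero_eq_one hjm hi hu hα hM hαM (m := c) (n := 0) ?_ h2 hcq hg
    rwa [zpow_zero, mul_one]
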